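/- Let $h, N \in \mathbb{N} = \{1,2,\ldots\}$ with $N \le h$, put $d = 3h+1$, let $a < b$ be real numbers, let $a = x_0 < x_1 < \cdots < x_N = b$, and let $f \in C([a,b],\mathbb{R})$ be affine linear on each interval $[x_{i-1},x_i]$, $i \in \{1,\ldots,N\}$. Let $p \colon [a,b] \to (0,\infty)$ be Lipschitz continuous. Let $R_\infty(x) = \max\{x,0\}$, and let $R_r \in C^1(\mathbb{R},\mathbb{R})$, $r \in \mathbb{N}$, satisfy for all $x \in \mathbb{R}$ that $\sup_{r \in \mathbb{N}} \sup_{y \in [-|x|,|x|]} |R_r'(y)| < \infty$ and $$\limsup_{r\to\infty} \bigl( |R_r(x) - R_\infty(x)| + |R_r'(x) - \mathbf{1}_{(0,\infty)}(x)| \bigr) = 0 .$$ For $r \in \mathbb{N} \cup \{\infty\}$ and $\theta = (\theta_1,\ldots,\theta_d) \in \mathbb{R}^d$ let $$\mathcal{L}_r(\theta) = \int_a^b \Bigl( f(x) - \theta_d - \sum_{j=1}^h \theta_{2h+j}\, R_r(\theta_j x + \theta_{h+j}) \Bigr)^2 p(x)\, dx .$$ Let $\mathcal{G} \colon \mathbb{R}^d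 \to \mathbb{R}^d$ satisfy $\mathcal{G}(\theta) = \lim_{r\to\infty} (\nabla \mathcal{L}_r)(\theta)$ for every $\theta \in \mathbb{R}^d$ at which the sequence $((\nabla\mathcal{L}_r)(\theta))_{r \in \mathbb{N}}$ converges. Let $(\Omega,\mathcal{F},\mathbb{P})$ be a probability space and let $\Theta_n^\gamma \colon \Omega \to \mathbb{R}^d$, $\gamma \in \mathbb{R}$, $n \in \mathbb{N}_0$, be random variables such that for every $\gamma \in \mathbb{R}$ the initial value $\Theta_0^\gamma$ is standard normally distributed and such that for all $\gamma \in \mathbb{R}$, $n \in \mathbb{N}_0$, $\omega \in \Omega$ $$\Theta_{n+1}^\gamma(\omega) = \Theta_n^\gamma(\omega) - \gamma\, \mathcal{G}(\Theta_n^\gamma(\omega)) .$$ Then there exist $c, C \in (0,\infty)$ such that for all $\gamma \in (0,c]$ $$\mathbb{P}\Bigl( \limsup_{n\to\infty} \mathcal{L}_\infty(\Theta_n^\gamma) = 0 \Bigr) \;\ge\; \mathbb{P}\bigl( \forall\, n \in \mathbb{N}_0 \colon \mathcal{L}_\infty(\Theta_n^\gamma) \le C \exp(-c\gamma n) \bigr)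 \;\ge\; c \;>\; 0 .$$ -/

import Mathlib

open Set Filter Topology MeasureTheory ProbabilityTheory
open scoped Gradient

/-- The parameter space `ℝ^(3h+1)` (with its Euclidean structure) of networks with one input neuron,
`h` hidden neurons and one output neuron. -/
abbrev ParamSpace (h : ℕ) : Type := EuclideanSpace ℝ (Fin (3 * h + 1))

namespace ParamSpace

variable {h : ℕ}

/-- Inner weight of hidden neuron `j`: the coordinates `1, …, h` of `θ` (counted from `1`). -/
def innerWeight (θ : ParamSpace h) (j : Fin h) : ℝ := θ ⟨j, by omega⟩

/-- Bias of hidden neuron `j`: the coordinates `h + 1, …, 2h` of `θ` (counted from `1`). -/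
def innerBias (θ : ParamSpace h) (j : Fin h) : ℝ := θ ⟨h + j, by omega⟩

/-- Outer weight of hidden neuron `j`: the coordinates `2h + 1, …, 3h` of `θ` (counted from `1`). -/
def outerWeight (θ : ParamSpace h) (j : Fin h) : ℝ := θ ⟨2 * h + j, by omega⟩

/-- Bias of the output neuron: the last coordinate of `θ`. -/
def outerBias (θ : ParamSpace h) : ℝ := θ ⟨3 * h, by omega⟩

end ParamSpace

/-- The rectified linear unit. -/
noncomputable def relu (x : ℝ) : ℝ := max x 0

/-- The function computed by the network with activation `σ` and parameters `θ`. -/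
noncomputable def realization {h : ℕ} (σ : ℝ → ℝ) (θ : ParamSpace h) (x : ℝ) : ℝ :=
  θ.outerBias + ∑ j : Fin h, θ.outerWeight j * σ (θ.innerWeight j * x + θ.innerBias j)

/-- The risk of the network with activation `σ` and parameters `θ`, for the target function `f` and
the unnormalized density `p` on `[a, b]`. -/
noncomputable def risk {h : ℕ} (a b : ℝ) (f p : ℝ → ℝ) (σ : ℝ → ℝ) (θ : ParamSpace h) : ℝ :=
  ∫ x in a..b, (f x - realization σ θ x) ^ 2 * p x

/-- `R 0, R 1, …` are continuously differentiable functions that approximate the rectified linear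
unit: their derivatives are bounded on every interval `[-|x|, |x|]`, uniformly in the index, and
values and derivatives converge pointwise to `max x 0` and to the indicator of `(0, ∞)`. -/
structure ApproximatesRelu (R : ℕ → ℝ → ℝ) : Prop where
  contDiff : ∀ r, ContDiff ℝ 1 (R r)
  deriv_bounded : ∀ x : ℝ, ∃ M : ℝ, ∀ r, ∀ y ∈ Icc (-|x|) |x|, |deriv (R r) y| ≤ M
  limsup_eq_zero : ∀ x : ℝ,
    limsup (fun r => ((|R r x - relu x| + |deriv (R r) x - (Ioi (0 : ℝ)).indicator 1 x| : ℝ) : EReal))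
      atTop = 0

/-- `G` is a generalized gradient of the risk of the network with rectified linear units: at every
`θ` at which the gradients of the risks with activations `R r` converge as `r → ∞`, the value of
`G` is their limit. -/
def IsGeneralizedGradient {h : ℕ} (a b : ℝ) (f p : ℝ → ℝ) (R : ℕ → ℝ → ℝ)
    (G : ParamSpace h → ParamSpace h) : Prop :=
  ∀ θ g : ParamSpace h,
    Tendsto (fun r => ∇ (fun ϑ : ParamSpace h => risk a b f p (R r) ϑ) θ) atTop (𝓝 g) → G θ = g

/-- The Heaviside step function, the pointwise limit of the derivatives of the approximations of the
rectified linear unit. -/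
noncomputable def step : ℝ → ℝ := (Ioi (0 : ℝ)).indicator 1

theorem step_of_pos {x : ℝ} (hx : 0 < x) : step x = 1 := by simp [step, hx]

theorem step_of_nonpos {x : ℝ} (hx : x ≤ 0) : step x = 0 := by simp [step, hx]

theorem continuous_relu : Continuous relu := by
  unfold relu; fun_prop

theorem relu_eq_mul_step (x : ℝ) : relu x = x * step x := by
  rcases lt_or_ge 0 x with hx | hx
  · simp [step_of_pos hx, relu, hx.le]
  · simp [step_of_nonpos hx, relu, hx]

namespace ParamSpace

variable {h : ℕ}

/-- The input of the activation function of hidden neuron `j`. -/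
noncomputable def preAct (θ : ParamSpace h) (j : Fin h) (x : ℝ) : ℝ :=
  θ.innerWeight j * x + θ.innerBias j

/-- Reading an inner weight as a continuous linear map. -/
noncomputable def innerWeightL (j : Fin h) : ParamSpace h →L[ℝ] ℝ :=
  EuclideanSpace.proj ⟨j, by omega⟩

/-- Reading an inner bias as a continuous linear map. -/
noncomputable def innerBiasL (j : Fin h) : ParamSpace h →L[ℝ] ℝ :=
  EuclideanSpace.proj ⟨h + j, by omega⟩

/-- Reading an outer weight as a continuous linear map. -/
noncomputable def outerWeightL (j : Fin h) : ParamSpace h →L[ℝ] ℝ :=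
  EuclideanSpace.proj ⟨2 * h + j, by omega⟩

/-- Reading the outer bias as a continuous linear map. -/
noncomputable def outerBiasL : ParamSpace h →L[ℝ] ℝ :=
  EuclideanSpace.proj ⟨3 * h, by omega⟩

@[simp] theorem innerWeightL_apply (j : Fin h) (θ : ParamSpace h) :
    innerWeightL j θ = θ.innerWeight j := rfl

@[simp] theorem innerBiasL_apply (j : Fin h) (θ : ParamSpace h) :
    innerBiasL j θ = θ.innerBias j := rfl

@[simp] theorem outerWeightL_apply (j : Fin h) (θ : ParamSpace h) :
    outerWeightL j θ = θ.outerWeight j := rfl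

@[simp] theorem outerBiasL_apply (θ : ParamSpace h) : outerBiasL θ = θ.outerBias := rfl

@[fun_prop] theorem continuous_innerWeight (j : Fin h) :
    Continuous fun θ : ParamSpace h => θ.innerWeight j := (innerWeightL j).continuous

@[fun_prop] theorem continuous_innerBias (j : Fin h) :
    Continuous fun θ : ParamSpace h => θ.innerBias j := (innerBiasL j).continuous

@[fun_prop] theorem continuous_outerWeight (j : Fin h) :
    Continuous fun θ : ParamSpace h => θ.outerWeight j := (outerWeightL j).continuous

@[fun_prop] theorem continuous_outerBias :
    Continuous fun θ : ParamSpace h => θ.outerBias := outerBiasL.continuous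

/-- The derivative of the preactivation of neuron `j` at the point `x`. -/
noncomputable def preActL (j : Fin h) (x : ℝ) : ParamSpace h →L[ℝ] ℝ :=
  x • innerWeightL j + innerBiasL j

@[simp] theorem preActL_apply (j : Fin h) (x : ℝ) (θ : ParamSpace h) :
    preActL j x θ = θ.preAct j x := by
  simp [preActL, preAct, mul_comm]

theorem continuous_preActL (j : Fin h) : Continuous (preActL (h := h) j) := by
  unfold preActL; fun_prop

theorem continuous_preAct (j : Fin h) :
    Continuous fun q : ParamSpace h × ℝ => q.1.preAct j q.2 := by
  have h1 : Continuous fun q : ParamSpace h × ℝ => q.1.innerWeight j :=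
    (continuous_innerWeight j).comp continuous_fst
  have h2 : Continuous fun q : ParamSpace h × ℝ => q.1.innerBias j :=
    (continuous_innerBias j).comp continuous_fst
  exact (h1.mul continuous_snd).add h2

end ParamSpace

open ParamSpace

section Gradient

variable {h : ℕ} {a b : ℝ} {f p : ℝ → ℝ} {σ σ' : ℝ → ℝ}

/-- The derivative with respect to the parameters of the realization of the network with activation
`σ`, where `σ'` stands in for the derivative of `σ`. -/
noncomputable def realizationDeriv (σ σ' : ℝ → ℝ) (θ : ParamSpace h) (x : ℝ) :
    ParamSpace h →L[ℝ] ℝ :=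
  outerBiasL + ∑ j : Fin h, (σ (θ.preAct j x) • outerWeightL j +
    (θ.outerWeight j * σ' (θ.preAct j x)) • preActL j x)

theorem realizationDeriv_apply (σ σ' : ℝ → ℝ) (θ u : ParamSpace h) (x : ℝ) :
    realizationDeriv σ σ' θ x u = u.outerBias + ∑ j : Fin h, (u.outerWeight j * σ (θ.preAct j x) +
      θ.outerWeight j * σ' (θ.preAct j x) * u.preAct j x) := by
  simp [realizationDeriv, mul_comm]

theorem hasFDerivAt_realization (hσ : ∀ y, HasDerivAt σ (σ' y) y) (θ : ParamSpace h) (x : ℝ) :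
    HasFDerivAt (fun ϑ => realization σ ϑ x) (realizationDeriv σ σ' θ x) θ := by
  unfold realization realizationDeriv
  refine (outerBiasL.hasFDerivAt (x := θ)).add (HasFDerivAt.fun_sum fun j _ => ?_)
  have h1 : HasFDerivAt (fun ϑ : ParamSpace h => ϑ.outerWeight j) (outerWeightL j) θ :=
    (outerWeightL j).hasFDerivAt
  have h2 : HasFDerivAt (fun ϑ : ParamSpace h => ϑ.preAct j x) (preActL j x) θ := by
    rw [show (fun ϑ : ParamSpace h => ϑ.preAct j x) = preActL j x from
      funext fun ϑ => (preActL_apply j x ϑ).symm]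
    exact (preActL j x).hasFDerivAt
  have h3 := (hσ (θ.preAct j x)).comp_hasFDerivAt θ h2
  refine (h1.mul h3).congr_fderiv ?_
  rw [smul_smul]
  exact add_comm _ _

/-- The derivative of the integrand of the risk. -/
noncomputable def riskDeriv (f p σ σ' : ℝ → ℝ) (θ : ParamSpace h) (x : ℝ) :
    ParamSpace h →L[ℝ] ℝ :=
  (2 * (realization σ θ x - f x) * p x) • realizationDeriv σ σ' θ x

theorem hasFDerivAt_risk_integrand (hσ : ∀ y, HasDerivAt σ (σ' y) y) (θ : ParamSpace h) (x : ℝ) :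
    HasFDerivAt (fun ϑ => (f x - realization σ ϑ x) ^ 2 * p x) (riskDeriv f p σ σ' θ x) θ := by
  have h1 := (((hasFDerivAt_realization hσ θ x).const_sub (f x)).pow 2).mul_const (p x)
  refine h1.congr_fderiv ?_
  rw [riskDeriv, smul_neg, smul_neg, smul_smul, ← neg_smul]
  congr 1
  simp
  ring

theorem continuous_realization (hσ : Continuous σ) :
    Continuous fun q : ParamSpace h × ℝ => realization σ q.1 q.2 := by
  refine (continuous_outerBias.comp continuous_fst).add (continuous_finsetSum _ fun j _ => ?_)
  exact ((continuous_outerWeight j).comp continuous_fst).mul (hσ.comp (continuous_preAct j))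

theorem continuous_realizationDeriv (hσ : Continuous σ) (hσ' : Continuous σ') :
    Continuous fun q : ParamSpace h × ℝ => realizationDeriv σ σ' q.1 q.2 := by
  refine (continuous_const (y := outerBiasL (h := h))).add (continuous_finsetSum _ fun j _ => ?_)
  refine ((hσ.comp (continuous_preAct j)).smul
    (continuous_const (y := outerWeightL (h := h) j))).add ?_
  exact (((continuous_outerWeight j).comp continuous_fst).mul
    (hσ'.comp (continuous_preAct j))).smul ((continuous_preActL j).comp continuous_snd)

theorem continuous_riskDeriv (hf : Continuous f) (hp : Continuous p) (hσ : Continuous σ)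
    (hσ' : Continuous σ') :
    Continuous fun q : ParamSpace h × ℝ => riskDeriv f p σ σ' q.1 q.2 := by
  have h1 := (continuous_const (y := (2 : ℝ))).mul
    ((continuous_realization (h := h) hσ).sub (hf.comp continuous_snd))
  exact (h1.mul (hp.comp continuous_snd)).smul (continuous_realizationDeriv hσ hσ')

theorem hasFDerivAt_risk (hf : Continuous f) (hp : Continuous p)
    (hσ : ∀ y, HasDerivAt σ (σ' y) y) (hσ' : Continuous σ') (θ : ParamSpace h) :
    HasFDerivAt (fun ϑ => risk a b f p σ ϑ) (∫ x in a..b, riskDeriv f p σ σ' θ x) θ := by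
  have hσc : Continuous σ := continuous_iff_continuousAt.2 fun y => (hσ y).continuousAt
  have hcont := continuous_riskDeriv (h := h) hf hp hσc hσ'
  have hF : ∀ ϑ : ParamSpace h, Continuous fun x => (f x - realization σ ϑ x) ^ 2 * p x :=
    fun ϑ => ((hf.sub ((continuous_realization hσc).comp (by fun_prop : Continuous fun x : ℝ =>
      (ϑ, x)))).pow 2).mul hp
  have hF' : Continuous (riskDeriv f p σ σ' θ) :=
    hcont.comp (by fun_prop : Continuous fun x : ℝ => (θ, x))
  obtain ⟨C, hC⟩ := ((isCompact_closedBall θ 1).prod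
    (isCompact_uIcc (a := a) (b := b))).exists_bound_of_continuousOn hcont.continuousOn
  refine intervalIntegral.hasFDerivAt_integral_of_dominated_of_fderiv_le (bound := fun _ => C)
    (Metric.closedBall_mem_nhds θ one_pos) ?_ ?_ ?_ ?_ ?_ ?_
  · exact Eventually.of_forall fun ϑ => (hF ϑ).aestronglyMeasurable
  · exact (hF θ).intervalIntegrable _ _
  · exact hF'.aestronglyMeasurable
  · exact Eventually.of_forall fun x hx ϑ hϑ => hC (ϑ, x) ⟨hϑ, uIoc_subset_uIcc hx⟩
  · exact intervalIntegrable_const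
  · exact Eventually.of_forall fun x _ ϑ _ => hasFDerivAt_risk_integrand hσ ϑ x

end Gradient

section BoundedLimit

/-- The sequence `u` converges to `v` pointwise on `s` and is bounded uniformly on `s`. -/
def BoundedTendstoOn {E : Type*} [NormedAddCommGroup E] (s : Set ℝ) (u : ℕ → ℝ → E) (v : ℝ → E) :
    Prop :=
  (∃ C, ∀ᶠ r in atTop, ∀ x ∈ s, ‖u r x‖ ≤ C) ∧ ∀ x ∈ s, Tendsto (fun r => u r x) atTop (𝓝 (v x))

namespace BoundedTendstoOn

variable {E : Type*} [NormedAddCommGroup E] {s : Set ℝ} {u u' : ℕ → ℝ → E} {v v' : ℝ → E}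

theorem add (h : BoundedTendstoOn s u v) (h' : BoundedTendstoOn s u' v') :
    BoundedTendstoOn s (fun r x => u r x + u' r x) fun x => v x + v' x := by
  obtain ⟨⟨C, hC⟩, hl⟩ := h
  obtain ⟨⟨C', hC'⟩, hl'⟩ := h'
  refine ⟨⟨C + C', ?_⟩, fun x hx => (hl x hx).add (hl' x hx)⟩
  filter_upwards [hC, hC'] with r h1 h2 x hx
  exact (norm_add_le _ _).trans (add_le_add (h1 x hx) (h2 x hx))

theorem sum {ι : Type*} (t : Finset ι) {u : ι → ℕ → ℝ → E} {v : ι → ℝ → E}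
    (h : ∀ i ∈ t, BoundedTendstoOn s (u i) (v i)) :
    BoundedTendstoOn s (fun r x => ∑ i ∈ t, u i r x) fun x => ∑ i ∈ t, v i x := by
  classical
  induction t using Finset.induction_on with
  | empty => exact ⟨⟨0, by simp⟩, by simp⟩
  | insert i t hi ih =>
    simp only [Finset.sum_insert hi]
    exact (h i (by simp)).add (ih fun j hj => h j (by simp [hj]))

theorem smul [NormedSpace ℝ E] {c : ℕ → ℝ → ℝ} {d : ℝ → ℝ} (h : BoundedTendstoOn s c d)
    (h' : BoundedTendstoOn s u v) :
    BoundedTendstoOn s (fun r x => c r x • u r x) fun x => d x • v x := by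
  obtain ⟨⟨C, hC⟩, hl⟩ := h
  obtain ⟨⟨C', hC'⟩, hl'⟩ := h'
  refine ⟨⟨C * C', ?_⟩, fun x hx => (hl x hx).smul (hl' x hx)⟩
  filter_upwards [hC, hC'] with r h1 h2 x hx
  rw [norm_smul]
  exact mul_le_mul (h1 x hx) (h2 x hx) (norm_nonneg _) ((norm_nonneg _).trans (h1 x hx))

theorem of_continuous {a b : ℝ} {w : ℝ → E} (hw : Continuous w) :
    BoundedTendstoOn (uIcc a b) (fun _ => w) w := by
  obtain ⟨C, hC⟩ := (isCompact_uIcc (a := a) (b := b)).exists_bound_of_continuousOn hw.continuousOn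
  exact ⟨⟨C, Eventually.of_forall fun _ => hC⟩, fun x _ => tendsto_const_nhds⟩

theorem comp {t : Set ℝ} (h : BoundedTendstoOn t u v) {g : ℝ → ℝ} (hg : MapsTo g s t) :
    BoundedTendstoOn s (fun r x => u r (g x)) fun x => v (g x) := by
  obtain ⟨⟨C, hC⟩, hl⟩ := h
  exact ⟨⟨C, hC.mono fun r h1 x hx => h1 _ (hg hx)⟩, fun x hx => hl _ (hg hx)⟩

theorem tendsto_integral [NormedSpace ℝ E] {a b : ℝ} (h : BoundedTendstoOn (uIcc a b) u v)
    (hu : ∀ r, Continuous (u r)) :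
    Tendsto (fun r => ∫ x in a..b, u r x) atTop (𝓝 (∫ x in a..b, v x)) := by
  obtain ⟨⟨C, hC⟩, hl⟩ := h
  refine intervalIntegral.tendsto_integral_filter_of_dominated_convergence (fun _ => C) ?_ ?_
    intervalIntegrable_const ?_
  · exact Eventually.of_forall fun r => (hu r).aestronglyMeasurable
  · exact hC.mono fun r h1 => Eventually.of_forall fun x hx => h1 x (uIoc_subset_uIcc hx)
  · exact Eventually.of_forall fun x hx => hl x (uIoc_subset_uIcc hx)

theorem intervalIntegrable {a b : ℝ} (h : BoundedTendstoOn (uIcc a b) u v)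
    (hu : ∀ r, Continuous (u r)) : IntervalIntegrable v volume a b := by
  obtain ⟨⟨C, hC⟩, hl⟩ := h
  refine (intervalIntegrable_const (c := C)).mono_fun ?_ ?_
  · refine aestronglyMeasurable_of_tendsto_ae atTop (fun r => (hu r).aestronglyMeasurable) ?_
    filter_upwards [ae_restrict_mem measurableSet_uIoc] with x hx
    exact hl x (uIoc_subset_uIcc hx)
  · filter_upwards [ae_restrict_mem measurableSet_uIoc] with x hx
    refine (le_of_tendsto (hl x (uIoc_subset_uIcc hx)).norm ?_).trans (le_abs_self C)
    exact hC.mono fun r h1 => h1 x (uIoc_subset_uIcc hx)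

end BoundedTendstoOn

end BoundedLimit

namespace ApproximatesRelu

variable {R : ℕ → ℝ → ℝ}

theorem tendsto_abs_add_abs (hR : ApproximatesRelu R) (x : ℝ) :
    Tendsto (fun r => |R r x - relu x| + |deriv (R r) x - step x|) atTop (𝓝 0) := by
  rw [← EReal.tendsto_coe]
  refine tendsto_of_le_liminf_of_limsup_le ?_ ((hR.limsup_eq_zero x).le.trans (by simp))
  refine le_liminf_of_le (by isBoundedDefault) (Eventually.of_forall fun r => ?_)
  exact_mod_cast add_nonneg (abs_nonneg _) (abs_nonneg _)

theorem tendsto_apply (hR : ApproximatesRelu R) (x : ℝ) :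
    Tendsto (fun r => R r x) atTop (𝓝 (relu x)) := by
  rw [tendsto_iff_norm_sub_tendsto_zero]
  exact squeeze_zero (fun _ => norm_nonneg _) (fun r => by
    simp) (hR.tendsto_abs_add_abs x)

theorem tendsto_deriv (hR : ApproximatesRelu R) (x : ℝ) :
    Tendsto (fun r => deriv (R r) x) atTop (𝓝 (step x)) := by
  rw [tendsto_iff_norm_sub_tendsto_zero]
  exact squeeze_zero (fun _ => norm_nonneg _) (fun r => by
    simp) (hR.tendsto_abs_add_abs x)

theorem differentiable (hR : ApproximatesRelu R) (r : ℕ) : Differentiable ℝ (R r) :=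
  (hR.contDiff r).differentiable one_ne_zero

theorem continuous_deriv (hR : ApproximatesRelu R) (r : ℕ) : Continuous (deriv (R r)) :=
  (hR.contDiff r).continuous_deriv le_rfl

theorem boundedTendstoOn_deriv (hR : ApproximatesRelu R) (B : ℝ) :
    BoundedTendstoOn (Icc (-|B|) |B|) (fun r => deriv (R r)) step := by
  obtain ⟨M, hM⟩ := hR.deriv_bounded B
  exact ⟨⟨M, Eventually.of_forall fun r y hy => hM r y hy⟩, fun x _ => hR.tendsto_deriv x⟩

theorem boundedTendstoOn (hR : ApproximatesRelu R) (B : ℝ) :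
    BoundedTendstoOn (Icc (-|B|) |B|) R relu := by
  obtain ⟨M, hM⟩ := hR.deriv_bounded B
  have h0 : ∀ᶠ r in atTop, |R r 0| < 1 := by
    have := (hR.tendsto_apply 0).abs
    simp only [relu, max_self, abs_zero] at this
    exact this.eventually (gt_mem_nhds one_pos)
  refine ⟨⟨1 + M * |B|, ?_⟩, fun x _ => hR.tendsto_apply x⟩
  filter_upwards [h0] with r hr y hy
  have hmem : (0 : ℝ) ∈ Icc (-|B|) |B| := by simp
  have h1 := (convex_Icc (-|B|) |B|).norm_image_sub_le_of_norm_deriv_le (𝕜 := ℝ) (f := R r) (C := M)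
    (fun x _ => hR.differentiable r x) (fun x hx => hM r x hx) hmem hy
  have hM0 : 0 ≤ M := (abs_nonneg _).trans (hM r 0 hmem)
  have h2 : |y| ≤ |B| := abs_le.2 hy
  have h3 : M * |y| ≤ M * |B| := mul_le_mul_of_nonneg_left h2 hM0
  simp only [Real.norm_eq_abs, sub_zero] at h1 ⊢
  have h4 := abs_sub_abs_le_abs_sub (R r y) (R r 0)
  linarith

variable {h : ℕ} {a b : ℝ} {f p : ℝ → ℝ}

theorem continuous_riskDeriv (hR : ApproximatesRelu R) (hf : Continuous f) (hp : Continuous p)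
    (θ : ParamSpace h) (r : ℕ) : Continuous (riskDeriv f p (R r) (deriv (R r)) θ) :=
  (_root_.continuous_riskDeriv hf hp (hR.differentiable r).continuous
    (hR.continuous_deriv r)).comp (by fun_prop : Continuous fun x : ℝ => (θ, x))

theorem boundedTendstoOn_riskDeriv (hR : ApproximatesRelu R) (hf : Continuous f)
    (hp : Continuous p) (θ : ParamSpace h) :
    BoundedTendstoOn (uIcc a b) (fun r => riskDeriv f p (R r) (deriv (R r)) θ)
      (riskDeriv f p relu step θ) := by
  have hz : ∀ j, Continuous (θ.preAct j) := fun j =>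
    (continuous_preAct j).comp (by fun_prop : Continuous fun x : ℝ => (θ, x))
  have hB : ∀ j, ∃ B, MapsTo (θ.preAct j) (uIcc a b) (Icc (-|B|) |B|) := by
    intro j
    obtain ⟨B, hB⟩ := (isCompact_uIcc (a := a) (b := b)).exists_bound_of_continuousOn
      (hz j).continuousOn
    exact ⟨B, fun x hx => abs_le.1 ((hB x hx).trans (le_abs_self B))⟩
  have h1 : ∀ j, BoundedTendstoOn (uIcc a b) (fun r x => R r (θ.preAct j x))
      fun x => relu (θ.preAct j x) := fun j =>
    let ⟨B, hB⟩ := hB j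
    (hR.boundedTendstoOn B).comp hB
  have h2 : ∀ j, BoundedTendstoOn (uIcc a b) (fun r x => deriv (R r) (θ.preAct j x))
      fun x => step (θ.preAct j x) := fun j =>
    let ⟨B, hB⟩ := hB j
    (hR.boundedTendstoOn_deriv B).comp hB
  have hc : ∀ c : ℝ, BoundedTendstoOn (uIcc a b) (fun _ _ => c) fun _ => c := fun c =>
    .of_continuous continuous_const
  have hreal : BoundedTendstoOn (uIcc a b) (fun r => realization (R r) θ) (realization relu θ) :=
    (hc θ.outerBias).add (.sum _ fun j _ => (hc (θ.outerWeight j)).smul (h1 j))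
  have hd : BoundedTendstoOn (uIcc a b) (fun r => realizationDeriv (R r) (deriv (R r)) θ)
      (realizationDeriv relu step θ) :=
    (BoundedTendstoOn.of_continuous continuous_const).add (.sum _ fun j _ =>
      ((h1 j).smul (.of_continuous continuous_const)).add
        (((hc (θ.outerWeight j)).smul (h2 j)).smul (.of_continuous (continuous_preActL j))))
  refine BoundedTendstoOn.smul (BoundedTendstoOn.smul ((hc 2).smul ?_) (.of_continuous hp)) hd
  simp only [sub_eq_add_neg]
  exact hreal.add (.of_continuous hf.neg)

end ApproximatesRelu

section Formula

variable {h : ℕ} {a b : ℝ} {f p : ℝ → ℝ} {R : ℕ → ℝ → ℝ} {G : ParamSpace h → ParamSpace h}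

theorem IsGeneralizedGradient.eq_toDual_symm (hG : IsGeneralizedGradient a b f p R G)
    (hR : ApproximatesRelu R) (hf : Continuous f) (hp : Continuous p) (θ : ParamSpace h) :
    G θ = (InnerProductSpace.toDual ℝ (ParamSpace h)).symm
      (∫ x in a..b, riskDeriv f p relu step θ x) := by
  refine hG θ _ ?_
  have h1 : ∀ r, ∇ (fun ϑ : ParamSpace h => risk a b f p (R r) ϑ) θ =
      (InnerProductSpace.toDual ℝ (ParamSpace h)).symm
        (∫ x in a..b, riskDeriv f p (R r) (deriv (R r)) θ x) := fun r =>
    HasGradientAt.gradient (HasFDerivAt.hasGradientAt (hasFDerivAt_risk hf hp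
      (fun y => (hR.differentiable r y).hasDerivAt) (hR.continuous_deriv r) θ))
  simp only [h1]
  refine ((InnerProductSpace.toDual ℝ (ParamSpace h)).symm.continuous.tendsto _).comp ?_
  refine (hR.boundedTendstoOn_riskDeriv hf hp θ).tendsto_integral fun r => ?_
  exact hR.continuous_riskDeriv hf hp θ r

theorem measurable_preAct (θ : ParamSpace h) (j : Fin h) : Measurable (θ.preAct j) := by
  unfold preAct; fun_prop

theorem intervalIntegrable_riskDeriv (hf : Continuous f) (hp : Continuous p)
    (hR : ApproximatesRelu R) (θ : ParamSpace h) :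
    IntervalIntegrable (riskDeriv f p relu step θ) volume a b :=
  (hR.boundedTendstoOn_riskDeriv hf hp θ).intervalIntegrable (hR.continuous_riskDeriv hf hp θ)

/-- The generalized gradient is given at every point by the formal gradient of the risk. -/
theorem IsGeneralizedGradient.inner_eq (hG : IsGeneralizedGradient a b f p R G)
    (hR : ApproximatesRelu R) (hf : Continuous f) (hp : Continuous p) (θ u : ParamSpace h) :
    inner ℝ (G θ) u = ∫ x in a..b,
      2 * (realization relu θ x - f x) * p x * realizationDeriv relu step θ x u := by
  rw [hG.eq_toDual_symm hR hf hp, InnerProductSpace.toDual_symm_apply,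
    ContinuousLinearMap.intervalIntegral_apply (intervalIntegrable_riskDeriv hf hp hR θ)]
  rfl

end Formula

section GradientDescent

variable {E : Type*} [NormedAddCommGroup E] [InnerProductSpace ℝ E] {L : E → ℝ} {g : E → E}
  {θ : E} {μ C γ : ℝ}

theorem descent_step (hdesc : ∀ u, ‖u‖ ≤ 1 → L (θ + u) ≤ L θ + inner ℝ (g θ) u + C * ‖u‖ ^ 2)
    (hγ : 0 < γ) (hγC : 2 * C * γ ≤ 1) (hγg : γ * ‖g θ‖ ≤ 1) :
    L (θ - γ • g θ) ≤ L θ - γ / 2 * ‖g θ‖ ^ 2 := by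
  have hn : ‖-(γ • g θ)‖ = γ * ‖g θ‖ := by rw [norm_neg, norm_smul, Real.norm_of_nonneg hγ.le]
  have h1 := hdesc (-(γ • g θ)) (hn.trans_le hγg)
  rw [hn, ← sub_eq_add_neg, inner_neg_right, inner_smul_right, real_inner_self_eq_norm_sq] at h1
  have h2 : 0 ≤ (1 - 2 * C * γ) * (γ * ‖g θ‖ ^ 2) := by
    have : 0 ≤ 1 - 2 * C * γ := by linarith
    positivity
  nlinarith

theorem norm_le_of_descent (hL : ∀ ϑ, 0 ≤ L ϑ)
    (hdesc : ∀ u, ‖u‖ ≤ 1 → L (θ + u) ≤ L θ + inner ℝ (g θ) u + C * ‖u‖ ^ 2) (hC : 0 ≤ C) :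
    ‖g θ‖ ≤ L θ + C := by
  rcases eq_or_ne (g θ) 0 with h0 | h0
  · rw [h0, norm_zero]
    exact add_nonneg (hL θ) hC
  · have hg : ‖g θ‖ ≠ 0 := norm_ne_zero_iff.2 h0
    have hn : ‖-(‖g θ‖⁻¹ • g θ)‖ = 1 := by
      rw [norm_neg, norm_smul, norm_inv, norm_norm, inv_mul_cancel₀ hg]
    have h1 := hdesc _ hn.le
    rw [hn, inner_neg_right, inner_smul_right, real_inner_self_eq_norm_sq, pow_two, ← mul_assoc,
      inv_mul_cancel₀ hg] at h1
    have h2 := hL (θ + -(‖g θ‖⁻¹ • g θ))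
    linarith

theorem sqrt_risk_step {l l' n : ℝ} (hl : 0 ≤ l) (hl' : 0 ≤ l') (hn : 0 ≤ n) (hμ : 0 < μ)
    (hγ : 0 < γ) (hγμ : γ * μ ≤ 1) (hPL : μ * l ≤ n ^ 2) (hstep : l' ≤ l - γ / 2 * n ^ 2) :
    γ * n + 4 / √μ * √l' ≤ 4 / √μ * √l := by
  have hs : 0 < √μ := Real.sqrt_pos.2 hμ
  have hs2 : √μ ^ 2 = μ := Real.sq_sqrt hμ.le
  have hm : √μ * √l ≤ n := by
    rw [← Real.sqrt_mul hμ.le]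
    exact (Real.sqrt_le_sqrt hPL).trans_eq (Real.sqrt_sq hn)
  set t := γ * √μ * n / 4 with ht
  have ht0 : 0 ≤ t := by positivity
  have hl2 : √l ^ 2 = l := Real.sq_sqrt hl
  have ht2 : t ^ 2 ≤ √l ^ 2 := by
    have h1 : t ^ 2 = (γ * μ) * (γ * n ^ 2) / 16 := by
      rw [ht, div_pow, mul_pow, mul_pow, hs2]; ring
    have h2 : (γ * μ) * (γ * n ^ 2) ≤ 1 * (γ * n ^ 2) := by gcongr
    have h3 : 0 ≤ γ * n ^ 2 := by positivity
    rw [h1, hl2]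
    linarith
  have htl : t ≤ √l := (sq_le_sq₀ ht0 (Real.sqrt_nonneg _)).1 ht2
  have h1 : √l' ≤ √l - t := by
    refine Real.sqrt_le_iff.2 ⟨by linarith, ?_⟩
    have h2 : γ * n * (√μ * √l) ≤ γ * n * n := by gcongr
    have h3 : 2 * √l * t = γ * n * (√μ * √l) / 2 := by rw [ht]; ring
    nlinarith [sq_nonneg t]
  have h2 : 4 / √μ * t = γ * n := by rw [ht]; field_simp
  have h3 : 4 / √μ * √l' ≤ 4 / √μ * (√l - t) := by gcongr
  rw [mul_sub, h2] at h3
  linarith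

/-- Gradient descent converges exponentially fast to the infimum `0` of the risk if it starts close
to a zero of the risk around which the risk satisfies a Polyak–Łojasiewicz inequality and a quadratic
upper bound. -/
theorem exists_exp_bound_of_descent_of_pl {r : ℝ} (hr : 0 < r) (hμ : 0 < μ) (hC : 0 < C)
    (hL : ∀ ϑ, 0 ≤ L ϑ) (hLθ : L θ = 0)
    (hdesc : ∀ ϑ ∈ Metric.ball θ r, ∀ u, ‖u‖ ≤ 1 →
      L (ϑ + u) ≤ L ϑ + inner ℝ (g ϑ) u + C * ‖u‖ ^ 2)
    (hPL : ∀ ϑ ∈ Metric.ball θ r, μ * L ϑ ≤ ‖g ϑ‖ ^ 2) :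
    ∃ η > 0, ∃ c > 0, ∀ γ ∈ Ioc 0 c, ∀ s : ℕ → E, s 0 ∈ Metric.ball θ η →
      (∀ n, s (n + 1) = s n - γ • g (s n)) → ∀ n : ℕ, L (s n) ≤ Real.exp (-(c * γ * n)) := by
  set K := ‖g θ‖ + C
  have hK : 0 < K := by positivity
  have hLK : ∀ ϑ, ‖ϑ - θ‖ ≤ 1 → L ϑ ≤ K * ‖ϑ - θ‖ := by
    intro ϑ h1
    have h2 := hdesc θ (Metric.mem_ball_self hr) (ϑ - θ) h1
    rw [add_sub_cancel, hLθ] at h2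
    have h3 := real_inner_le_norm (g θ) (ϑ - θ)
    have h4 : C * ‖ϑ - θ‖ ^ 2 ≤ C * ‖ϑ - θ‖ := by
      have := norm_nonneg (ϑ - θ)
      gcongr
      nlinarith
    have h5 : K * ‖ϑ - θ‖ = ‖g θ‖ * ‖ϑ - θ‖ + C * ‖ϑ - θ‖ := by ring
    linarith
  set c := min (min (1 / (K + C)) (1 / (2 * C))) (min (μ / 2) (1 / μ)) with hc_def
  have hc : 0 < c := by positivity
  have hc1 : c ≤ 1 / (K + C) := (min_le_left _ _).trans (min_le_left _ _)
  have hc2 : c ≤ 1 / (2 * C) := (min_le_left _ _).trans (min_le_right _ _)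
  have hc3 : c ≤ μ / 2 := (min_le_right _ _).trans (min_le_left _ _)
  have hc4 : c ≤ 1 / μ := (min_le_right _ _).trans (min_le_right _ _)
  set V : E → ℝ := fun ϑ => ‖ϑ - θ‖ + 4 / √μ * √(L ϑ) with hV
  have hVle : ∀ ϑ, ‖ϑ - θ‖ ≤ V ϑ := fun ϑ => le_add_of_nonneg_right (by positivity)
  obtain ⟨η, ⟨⟨hη1, hη2⟩, hη3⟩, hη⟩ : ∃ η : ℝ, ((η < 1 ∧ K * η < 1) ∧
      η + 4 / √μ * √(K * η) < min r 1) ∧ 0 < η := by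
    have e1 : ∀ᶠ η : ℝ in 𝓝[>] 0, η < 1 :=
      nhdsWithin_le_nhds (gt_mem_nhds one_pos)
    have e2 : ∀ᶠ η : ℝ in 𝓝[>] 0, K * η < 1 := by
      have : Continuous fun η : ℝ => K * η := by fun_prop
      exact nhdsWithin_le_nhds ((this.tendsto' 0 0 (by simp)).eventually (gt_mem_nhds one_pos))
    have e3 : ∀ᶠ η : ℝ in 𝓝[>] 0, η + 4 / √μ * √(K * η) < min r 1 := by
      have : Continuous fun η : ℝ => η + 4 / √μ * √(K * η) := by fun_prop
      exact nhdsWithin_le_nhds ((this.tendsto' 0 0 (by simp)).eventually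
        (gt_mem_nhds (lt_min hr one_pos)))
    exact (((e1.and e2).and e3).and self_mem_nhdsWithin).exists
  refine ⟨η, hη, c, hc, fun γ hγ s hs0 hs => ?_⟩
  have hγ0 : 0 < γ := hγ.1
  rw [mem_ball_iff_norm] at hs0
  have hinv : ∀ n : ℕ, V (s n) < min r 1 ∧ L (s n) ≤ Real.exp (-(c * γ * n)) := by
    intro n
    induction n with
    | zero =>
      have h1 : L (s 0) ≤ K * η :=
        (hLK _ (hs0.le.trans hη1.le)).trans (by gcongr)
      refine ⟨lt_of_le_of_lt ?_ hη3, by simpa using h1.trans hη2.le⟩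
      simp only [hV]
      gcongr
    | succ n ih =>
      obtain ⟨ih1, ih2⟩ := ih
      have hd : ‖s n - θ‖ < min r 1 := (hVle _).trans_lt ih1
      have hmem : s n ∈ Metric.ball θ r := mem_ball_iff_norm.2 (hd.trans_le (min_le_left _ _))
      have hd1 : ‖s n - θ‖ ≤ 1 := (hd.trans_le (min_le_right _ _)).le
      have hLn : L (s n) ≤ K := (hLK _ hd1).trans (mul_le_of_le_one_right hK.le hd1)
      have hg : ‖g (s n)‖ ≤ K + C :=
        (norm_le_of_descent hL (hdesc _ hmem) hC.le).trans (by linarith)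
      have hγg : γ * ‖g (s n)‖ ≤ 1 := by
        calc γ * ‖g (s n)‖ ≤ 1 / (K + C) * (K + C) := by
              gcongr
              exact hγ.2.trans hc1
          _ = 1 := by field_simp
      have hγC : 2 * C * γ ≤ 1 := by
        have := hγ.2.trans hc2
        rw [le_div_iff₀ (by positivity)] at this
        linarith
      have hγμ : γ * μ ≤ 1 := by
        have := hγ.2.trans hc4
        rwa [le_div_iff₀ hμ] at this
      have hstep := descent_step (hdesc _ hmem) hγ0 hγC hγg
      rw [← hs n] at hstep
      have hpl := hPL _ hmem
      constructor
      · refine lt_of_le_of_lt ?_ ih1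
        have h1 := sqrt_risk_step (hL (s n)) (hL (s (n + 1))) (norm_nonneg _) hμ hγ0 hγμ hpl hstep
        have h2 : ‖s (n + 1) - θ‖ ≤ ‖s n - θ‖ + γ * ‖g (s n)‖ := by
          rw [hs n, sub_right_comm]
          refine (norm_sub_le _ _).trans_eq ?_
          rw [norm_smul, Real.norm_of_nonneg hγ0.le]
        simp only [hV]
        linarith
      · have h1 : L (s (n + 1)) ≤ (1 - c * γ) * L (s n) := by
          have h2 : c * γ * L (s n) ≤ μ / 2 * γ * L (s n) := by
            have := hL (s n)
            gcongr
          have h3 : γ * (μ * L (s n)) ≤ γ * ‖g (s n)‖ ^ 2 := by gcongr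
          linarith
        have h2 : 1 - c * γ ≤ Real.exp (-(c * γ)) := by
          have := Real.add_one_le_exp (-(c * γ))
          linarith
        calc L (s (n + 1)) ≤ (1 - c * γ) * L (s n) := h1
          _ ≤ Real.exp (-(c * γ)) * Real.exp (-(c * γ * n)) :=
            mul_le_mul h2 ih2 (hL _) (Real.exp_nonneg _)
          _ = Real.exp (-(c * γ * (n + 1 : ℕ))) := by
            rw [← Real.exp_add]
            push_cast
            ring_nf
  exact fun n => (hinv n).2

end GradientDescent

theorem isOpenPosMeasure_gaussianReal (m : ℝ) {v : NNReal} (hv : v ≠ 0) :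
    (gaussianReal m v).IsOpenPosMeasure :=
  (gaussianReal_absolutelyContinuous' m hv).isOpenPosMeasure

theorem isOpenPosMeasure_stdGaussian (ι : Type*) [Fintype ι] :
    (stdGaussian (EuclideanSpace ℝ ι)).IsOpenPosMeasure := by
  have := isOpenPosMeasure_gaussianReal 0 one_ne_zero
  rw [← map_pi_eq_stdGaussian]
  exact (PiLp.continuous_toLp 2 _).isOpenPosMeasure_map (WithLp.toLp_surjective 2)

section Scalar

theorem abs_relu_le (z : ℝ) : |relu z| ≤ |z| := by
  rcases le_total z 0 with hz | hz <;> simp [relu, hz]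

theorem abs_relu_add_sub_le (z d : ℝ) : |relu (z + d) - relu z| ≤ |d| := by
  simpa [relu] using abs_max_sub_max_le_abs (z + d) z 0

theorem abs_relu_remainder_le (z d s : ℝ) (hd : |d| ≤ s) :
    |relu (z + d) - relu z - step z * d| ≤ s * {y : ℝ | |y| ≤ s}.indicator 1 z := by
  have hs : 0 ≤ s := (abs_nonneg d).trans hd
  obtain ⟨hd1, hd2⟩ := abs_le.1 hd
  by_cases hz : |z| ≤ s
  · rw [indicator_of_mem (by exact hz), Pi.one_apply, mul_one]
    rcases lt_or_ge 0 z with h0 | h0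
    · rw [step_of_pos h0]
      rcases le_total (z + d) 0 with h1 | h1 <;> rw [abs_le] <;> simp [relu, h0.le, h1] <;>
        first | exact hs | (constructor <;> linarith)
    · rw [step_of_nonpos h0]
      rcases le_total (z + d) 0 with h1 | h1 <;> rw [abs_le] <;> simp [relu, h0, h1] <;>
        first | exact hs | (constructor <;> linarith)
  · rw [indicator_of_notMem (by exact hz), mul_zero]
    push Not at hz
    rcases lt_abs.1 hz with h0 | h0
    · have h1 : 0 < z := by linarith
      have h2 : 0 ≤ z + d := by linarith
      simp [step_of_pos h1, relu, h1.le, h2]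
    · have h1 : z ≤ 0 := by linarith
      have h2 : z + d ≤ 0 := by linarith
      simp [step_of_nonpos h1, relu, h1, h2]

end Scalar

section NearIndicator

variable {a b : ℝ}

theorem intervalIntegrable_indicator_one {S : Set ℝ} (hS : MeasurableSet S) :
    IntervalIntegrable (S.indicator (1 : ℝ → ℝ)) volume a b := by
  refine (intervalIntegrable_const (c := (1 : ℝ))).mono_fun
    (measurable_one.indicator hS).aestronglyMeasurable (Eventually.of_forall fun x => ?_)
  by_cases hx : x ∈ S <;> simp [hx]

theorem integral_indicator_abs_sub_le (hab : a ≤ b) (m : ℝ) {t : ℝ} (ht : 0 ≤ t) :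
    ∫ x in a..b, {x : ℝ | |x - m| ≤ t}.indicator 1 x ≤ 2 * t := by
  have hS : {x : ℝ | |x - m| ≤ t} = Icc (m - t) (m + t) := by
    ext x
    simp only [mem_ofPred_eq, abs_le, mem_Icc]
    constructor <;> rintro ⟨h1, h2⟩ <;> constructor <;> linarith
  rw [hS, intervalIntegral.integral_of_le hab, integral_indicator_one measurableSet_Icc,
    measureReal_restrict_apply measurableSet_Icc]
  refine (measureReal_mono inter_subset_left (by simp)).trans_eq ?_
  rw [Real.volume_real_Icc_of_le (by linarith)]
  ring

theorem integral_indicator_abs_affine_le (hab : a ≤ b) {w c s : ℝ} (hs : 0 ≤ s)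
    (h : 1 / 2 ≤ w ∨ ∀ x ∈ Icc a b, 1 / 2 ≤ |w * x + c|) :
    ∫ x in a..b, {y : ℝ | |y| ≤ s}.indicator 1 (w * x + c) ≤ (4 + 2 * (b - a)) * s := by
  have hmeas : MeasurableSet {x : ℝ | |w * x + c| ≤ s} :=
    (isClosed_le (by fun_prop) continuous_const).measurableSet
  have hint : IntervalIntegrable (fun x => {y : ℝ | |y| ≤ s}.indicator (1 : ℝ → ℝ) (w * x + c))
      volume a b := intervalIntegrable_indicator_one hmeas
  have hba : 0 ≤ b - a := sub_nonneg.2 hab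
  rcases h with h | h
  · have hw : 0 < w := by linarith
    have h1 : ∫ x in a..b, {y : ℝ | |y| ≤ s}.indicator (1 : ℝ → ℝ) (w * x + c) ≤
        ∫ x in a..b, {x : ℝ | |x - -c / w| ≤ 2 * s}.indicator 1 x := by
      refine intervalIntegral.integral_mono_on hab hint (intervalIntegrable_indicator_one
        (isClosed_le (by fun_prop) continuous_const).measurableSet) fun x _ => ?_
      by_cases hx : |w * x + c| ≤ s
      · have h2 : |x - -c / w| ≤ 2 * s := by
          have h3 : w * x + c = w * (x - -c / w) := by field_simp; ring
          rw [h3, abs_mul, abs_of_pos hw] at hx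
          nlinarith [abs_nonneg (x - -c / w)]
        rw [indicator_of_mem (by exact hx), indicator_of_mem (by exact h2)]
        rfl
      · rw [indicator_of_notMem (by exact hx)]
        exact indicator_nonneg (fun _ _ => zero_le_one) _
    refine (h1.trans (integral_indicator_abs_sub_le hab _ (by positivity))).trans ?_
    nlinarith
  · rcases lt_or_ge s (1 / 2) with h1 | h1
    · have h2 : ∫ x in a..b, {y : ℝ | |y| ≤ s}.indicator (1 : ℝ → ℝ) (w * x + c) =
          ∫ x in a..b, (0 : ℝ) := by
        refine intervalIntegral.integral_congr fun x hx => ?_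
        rw [uIcc_of_le hab] at hx
        exact indicator_of_notMem (by simpa using h1.trans_le (h x hx)) _
      rw [h2, intervalIntegral.integral_zero]
      positivity
    · have h2 : ∫ x in a..b, {y : ℝ | |y| ≤ s}.indicator (1 : ℝ → ℝ) (w * x + c) ≤
          ∫ x in a..b, (1 : ℝ) :=
        intervalIntegral.integral_mono_on hab hint intervalIntegrable_const fun x _ =>
          indicator_le_self' (fun _ _ => zero_le_one) _
      refine h2.trans ?_
      rw [intervalIntegral.integral_const, smul_eq_mul, mul_one]
      nlinarith

end NearIndicator

namespace ParamSpace

variable {h : ℕ}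

theorem abs_innerWeight_le (θ : ParamSpace h) (j : Fin h) : |θ.innerWeight j| ≤ ‖θ‖ :=
  PiLp.norm_apply_le θ _

theorem abs_innerBias_le (θ : ParamSpace h) (j : Fin h) : |θ.innerBias j| ≤ ‖θ‖ :=
  PiLp.norm_apply_le θ _

theorem abs_outerWeight_le (θ : ParamSpace h) (j : Fin h) : |θ.outerWeight j| ≤ ‖θ‖ :=
  PiLp.norm_apply_le θ _

theorem abs_outerBias_le (θ : ParamSpace h) : |θ.outerBias| ≤ ‖θ‖ :=
  PiLp.norm_apply_le θ _

theorem abs_preAct_le {M : ℝ} (hM : 1 ≤ M) (θ : ParamSpace h) (j : Fin h) {x : ℝ} (hx : |x| ≤ M) :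
    |θ.preAct j x| ≤ 2 * M * ‖θ‖ := by
  have h1 : |θ.innerWeight j * x| ≤ ‖θ‖ * M := by
    rw [abs_mul]
    exact mul_le_mul (abs_innerWeight_le θ j) hx (abs_nonneg _) (norm_nonneg _)
  have h2 := abs_add_le (θ.innerWeight j * x) (θ.innerBias j)
  have h3 := abs_innerBias_le θ j
  have h4 : ‖θ‖ ≤ ‖θ‖ * M := le_mul_of_one_le_right (norm_nonneg _) hM
  unfold preAct
  linarith

theorem preAct_add (θ u : ParamSpace h) (j : Fin h) (x : ℝ) :
    (θ + u).preAct j x = θ.preAct j x + u.preAct j x := by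
  simp only [← preActL_apply, map_add]

theorem preAct_sub (θ u : ParamSpace h) (j : Fin h) (x : ℝ) :
    (θ - u).preAct j x = θ.preAct j x - u.preAct j x := by
  simp only [← preActL_apply, map_sub]

theorem outerWeight_add (θ u : ParamSpace h) (j : Fin h) :
    (θ + u).outerWeight j = θ.outerWeight j + u.outerWeight j := rfl

theorem outerBias_add (θ u : ParamSpace h) :
    (θ + u).outerBias = θ.outerBias + u.outerBias := rfl

theorem realization_eq (σ : ℝ → ℝ) (θ : ParamSpace h) (x : ℝ) :
    realization σ θ x = θ.outerBias + ∑ j, θ.outerWeight j * σ (θ.preAct j x) := rfl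

theorem abs_realization_le {M B : ℝ} (hM : 1 ≤ M) {θ : ParamSpace h} (hθ : ‖θ‖ ≤ B) {x : ℝ}
    (hx : |x| ≤ M) : |realization relu θ x| ≤ B + h * (B * (2 * M * B)) := by
  have hB : 0 ≤ B := (norm_nonneg _).trans hθ
  rw [realization_eq]
  refine (abs_add_le _ _).trans (add_le_add ((abs_outerBias_le θ).trans hθ) ?_)
  refine (Finset.abs_sum_le_sum_abs _ _).trans ?_
  calc _ ≤ ∑ _j : Fin h, B * (2 * M * B) := Finset.sum_le_sum fun j _ => ?_
    _ = _ := by simp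
  rw [abs_mul]
  refine mul_le_mul ((abs_outerWeight_le θ j).trans hθ) ?_ (abs_nonneg _) hB
  exact (abs_relu_le _).trans ((abs_preAct_le hM θ j hx).trans (by gcongr))

theorem abs_realization_add_sub_le {M B : ℝ} (hM : 1 ≤ M) {θ u : ParamSpace h} (hθ : ‖θ‖ ≤ B)
    (hu : ‖u‖ ≤ 1) {x : ℝ} (hx : |x| ≤ M) :
    |realization relu (θ + u) x - realization relu θ x| ≤
      (1 + h * (2 * M * (2 * B + 1))) * ‖u‖ := by
  have hB : 0 ≤ B := (norm_nonneg _).trans hθ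
  have hsplit : realization relu (θ + u) x - realization relu θ x = u.outerBias +
      ∑ j, ((θ + u).outerWeight j * (relu (θ.preAct j x + u.preAct j x) - relu (θ.preAct j x)) +
        u.outerWeight j * relu (θ.preAct j x)) := by
    simp only [realization_eq, outerBias_add, outerWeight_add, preAct_add]
    rw [add_sub_add_comm, add_sub_cancel_left, ← Finset.sum_sub_distrib]
    congr 1
    exact Finset.sum_congr rfl fun j _ => by ring
  rw [hsplit, add_mul, one_mul]
  refine (abs_add_le _ _).trans (add_le_add (abs_outerBias_le u) ?_)
  refine (Finset.abs_sum_le_sum_abs _ _).trans ?_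
  calc _ ≤ ∑ _j : Fin h, 2 * M * (2 * B + 1) * ‖u‖ := Finset.sum_le_sum fun j _ => ?_
    _ = _ := by simp [mul_assoc]
  have h1 : |(θ + u).outerWeight j * (relu (θ.preAct j x + u.preAct j x) - relu (θ.preAct j x))| ≤
      (B + 1) * (2 * M * ‖u‖) := by
    rw [abs_mul]
    refine mul_le_mul ?_ ((abs_relu_add_sub_le _ _).trans (abs_preAct_le hM u j hx))
      (abs_nonneg _) (by positivity)
    exact (abs_outerWeight_le _ j).trans ((norm_add_le _ _).trans (add_le_add hθ hu))
  have h2 : |u.outerWeight j * relu (θ.preAct j x)| ≤ ‖u‖ * (2 * M * B) := by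
    rw [abs_mul]
    refine mul_le_mul (abs_outerWeight_le u j) ?_ (abs_nonneg _) (norm_nonneg _)
    exact (abs_relu_le _).trans ((abs_preAct_le hM θ j hx).trans (by gcongr))
  refine (abs_add_le _ _).trans ((add_le_add h1 h2).trans_eq ?_)
  ring

theorem abs_realization_remainder_le {M B : ℝ} (hM : 1 ≤ M) {θ u : ParamSpace h} (hθ : ‖θ‖ ≤ B)
    {x : ℝ} (hx : |x| ≤ M) :
    |realization relu (θ + u) x - realization relu θ x - realizationDeriv relu step θ x u| ≤
      h * (2 * M) * ‖u‖ ^ 2 + B * (2 * M) * ‖u‖ *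
        ∑ j, {y : ℝ | |y| ≤ 2 * M * ‖u‖}.indicator 1 (θ.preAct j x) := by
  have hB : 0 ≤ B := (norm_nonneg _).trans hθ
  have hsplit : realization relu (θ + u) x - realization relu θ x -
      realizationDeriv relu step θ x u =
      ∑ j, (u.outerWeight j * (relu (θ.preAct j x + u.preAct j x) - relu (θ.preAct j x)) +
        θ.outerWeight j * (relu (θ.preAct j x + u.preAct j x) - relu (θ.preAct j x) -
          step (θ.preAct j x) * u.preAct j x)) := by
    simp only [realization_eq, realizationDeriv_apply, outerBias_add, outerWeight_add, preAct_add]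
    rw [add_sub_add_comm, add_sub_cancel_left, add_sub_add_left_eq_sub, ← Finset.sum_sub_distrib,
      ← Finset.sum_sub_distrib]
    exact Finset.sum_congr rfl fun j _ => by ring
  rw [hsplit, Finset.mul_sum]
  refine (Finset.abs_sum_le_sum_abs _ _).trans ?_
  have hconst : h * (2 * M) * ‖u‖ ^ 2 = ∑ _j : Fin h, ‖u‖ * (2 * M * ‖u‖) := by
    simp only [Finset.sum_const, Finset.card_univ, Fintype.card_fin, nsmul_eq_mul]
    ring
  rw [hconst, ← Finset.sum_add_distrib]
  refine Finset.sum_le_sum fun j _ => (abs_add_le _ _).trans (add_le_add ?_ ?_)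
  · rw [abs_mul]
    exact mul_le_mul (abs_outerWeight_le u j)
      ((abs_relu_add_sub_le _ _).trans (abs_preAct_le hM u j hx)) (abs_nonneg _) (norm_nonneg _)
  · rw [abs_mul, mul_assoc B, mul_assoc B]
    exact mul_le_mul ((abs_outerWeight_le θ j).trans hθ)
      (abs_relu_remainder_le _ _ _ (abs_preAct_le hM u j hx)) (abs_nonneg _) hB

end ParamSpace

section Descent

variable {h : ℕ} {a b : ℝ} {f p : ℝ → ℝ} {R : ℕ → ℝ → ℝ} {G : ParamSpace h → ParamSpace h}

/-- Every hidden neuron either has an inner weight bounded away from `0` or a preactivation bounded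
away from `0` on `[a, b]`. -/
def IsTransversal (a b : ℝ) (θ : ParamSpace h) : Prop :=
  ∀ j, 1 / 2 ≤ θ.innerWeight j ∨ ∀ x ∈ Icc a b, 1 / 2 ≤ |θ.preAct j x|

theorem sq_le_of_remainder {e D N' E₀ C₁ C₂ : ℝ} (he : |e| ≤ E₀) (h1 : |N'| ≤ C₁)
    (h2 : |N' - D| ≤ C₂) : (e + N') ^ 2 ≤ e ^ 2 + 2 * e * D + (C₁ ^ 2 + 2 * E₀ * C₂) := by
  have h3 : N' ^ 2 ≤ C₁ ^ 2 := by
    rw [← sq_abs]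
    gcongr
  have h4 : e * (N' - D) ≤ E₀ * C₂ := by
    refine (le_abs_self _).trans ?_
    rw [abs_mul]
    exact mul_le_mul he h2 (abs_nonneg _) ((abs_nonneg _).trans he)
  nlinarith

theorem exists_abs_le_of_continuous {g : ℝ → ℝ} (hg : Continuous g) (a b : ℝ) :
    ∃ C, 1 ≤ C ∧ ∀ x ∈ Icc a b, |g x| ≤ C := by
  obtain ⟨C, hC⟩ := (isCompact_Icc (a := a) (b := b)).exists_bound_of_continuousOn hg.continuousOn
  exact ⟨max 1 C, le_max_left _ _, fun x hx => (hC x hx).trans (le_max_right _ _)⟩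

theorem continuous_realization_right {σ : ℝ → ℝ} (hσ : Continuous σ) (θ : ParamSpace h) :
    Continuous (realization σ θ) :=
  (continuous_realization hσ).comp (by fun_prop : Continuous fun x : ℝ => (θ, x))

theorem intervalIntegrable_risk (hf : Continuous f) (hp : Continuous p) (θ : ParamSpace h) :
    IntervalIntegrable (fun x => (f x - realization relu θ x) ^ 2 * p x) volume a b :=
  (((hf.sub (continuous_realization_right continuous_relu θ)).pow 2).mul hp).intervalIntegrable _ _

/-- The quadratic upper bound of the risk on bounded sets of transversal parameters. -/
theorem exists_risk_add_le (hab : a < b) (hf : Continuous f) (hp : Continuous p)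
    (hp_pos : ∀ x ∈ Icc a b, 0 < p x) (hR : ApproximatesRelu R)
    (hG : IsGeneralizedGradient a b f p R G) (B : ℝ) :
    ∃ C > 0, ∀ θ : ParamSpace h, ‖θ‖ ≤ B → IsTransversal a b θ → ∀ u, ‖u‖ ≤ 1 →
      risk a b f p relu (θ + u) ≤ risk a b f p relu θ + inner ℝ (G θ) u + C * ‖u‖ ^ 2 := by
  obtain ⟨M, hM, hxM⟩ := exists_abs_le_of_continuous (g := fun x => x) continuous_id a b
  obtain ⟨F, hF, hfF⟩ := exists_abs_le_of_continuous hf a b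
  obtain ⟨Q, hQ, hpQ⟩ := exists_abs_le_of_continuous hp a b
  set E₀ := B + h * (B * (2 * M * B)) + F with hE₀
  set C₁ := 1 + h * (2 * M * (2 * B + 1)) with hC₁
  set A := C₁ ^ 2 + 2 * E₀ * (h * (2 * M)) with hA
  set A' := 2 * E₀ * (B * (2 * M)) with hA'
  set C := Q * (A * (b - a) + A' * (h * ((4 + 2 * (b - a)) * (2 * M)))) with hC
  refine ⟨max C 1, by positivity, fun θ hθ ht u hu => ?_⟩
  have hB : 0 ≤ B := (norm_nonneg _).trans hθ
  have hba : 0 ≤ b - a := sub_nonneg.2 hab.le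
  have hE₀0 : 0 ≤ E₀ := by positivity
  set χ : ℝ → ℝ := fun x => ∑ j, {y : ℝ | |y| ≤ 2 * M * ‖u‖}.indicator 1 (θ.preAct j x) with hχ
  have hpt : ∀ x ∈ Icc a b, (f x - realization relu (θ + u) x) ^ 2 * p x ≤
      ((f x - realization relu θ x) ^ 2 * p x + riskDeriv f p relu step θ x u) +
        (Q * (A * ‖u‖ ^ 2) + Q * (A' * ‖u‖) * χ x) := by
    intro x hx
    have hχ0 : 0 ≤ χ x := Finset.sum_nonneg fun j _ => indicator_nonneg (fun _ _ => zero_le_one) _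
    have he : |realization relu θ x - f x| ≤ E₀ :=
      (abs_sub _ _).trans (add_le_add (abs_realization_le hM hθ (hxM x hx)) (hfF x hx))
    have h1 := sq_le_of_remainder he (abs_realization_add_sub_le hM hθ hu (hxM x hx))
      (abs_realization_remainder_le hM hθ (hxM x hx) (u := u))
    have hp0 := hp_pos x hx
    have hpx : p x ≤ Q := (le_abs_self _).trans (hpQ x hx)
    have h2 : (f x - realization relu (θ + u) x) ^ 2 ≤ (f x - realization relu θ x) ^ 2 +
        2 * (realization relu θ x - f x) * realizationDeriv relu step θ x u +
        (A * ‖u‖ ^ 2 + A' * ‖u‖ * χ x) := by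
      refine le_trans (le_of_eq ?_) (h1.trans (le_of_eq ?_))
      · ring
      · simp only [hA, hA', hC₁, hχ]
        ring
    have h3 : (A * ‖u‖ ^ 2 + A' * ‖u‖ * χ x) * p x ≤ (A * ‖u‖ ^ 2 + A' * ‖u‖ * χ x) * Q := by
      have : 0 ≤ A * ‖u‖ ^ 2 + A' * ‖u‖ * χ x := by positivity
      gcongr
    have h4 : riskDeriv f p relu step θ x u =
        2 * (realization relu θ x - f x) * p x * realizationDeriv relu step θ x u := rfl
    rw [h4]
    have h5 := mul_le_mul_of_nonneg_right h2 hp0.le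
    linarith
  have hi2 : IntervalIntegrable (fun x => riskDeriv f p relu step θ x u) volume a b :=
    ⟨(intervalIntegrable_riskDeriv hf hp hR θ).1.apply_continuousLinearMap u,
      (intervalIntegrable_riskDeriv hf hp hR θ).2.apply_continuousLinearMap u⟩
  have hχj : ∀ j, IntervalIntegrable
      (fun x => {y : ℝ | |y| ≤ 2 * M * ‖u‖}.indicator (1 : ℝ → ℝ) (θ.preAct j x)) volume a b :=
    fun j => intervalIntegrable_indicator_one
      ((measurable_preAct θ j).abs measurableSet_Iic : MeasurableSet {x | |θ.preAct j x| ≤ _})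
  have hχi : IntervalIntegrable χ volume a b := by
    simpa only [hχ, Finset.sum_fn] using IntervalIntegrable.sum Finset.univ fun j _ => hχj j
  have hχle : ∫ x in a..b, χ x ≤ h * ((4 + 2 * (b - a)) * (2 * M * ‖u‖)) := by
    rw [hχ, intervalIntegral.integral_finsetSum fun j _ => hχj j]
    calc _ ≤ ∑ _j : Fin h, (4 + 2 * (b - a)) * (2 * M * ‖u‖) :=
          Finset.sum_le_sum fun j _ =>
            integral_indicator_abs_affine_le hab.le (by positivity) (ht j)
      _ = _ := by simp
  have hint := intervalIntegral.integral_mono_on hab.le (intervalIntegrable_risk hf hp (θ + u))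
    (((intervalIntegrable_risk hf hp θ).add hi2).add
      (intervalIntegrable_const.add (hχi.const_mul (Q * (A' * ‖u‖))))) hpt
  rw [intervalIntegral.integral_add ((intervalIntegrable_risk hf hp θ).add hi2)
      (intervalIntegrable_const.add (hχi.const_mul _)),
    intervalIntegral.integral_add (intervalIntegrable_risk hf hp θ) hi2,
    intervalIntegral.integral_add intervalIntegrable_const (hχi.const_mul _),
    intervalIntegral.integral_const, intervalIntegral.integral_const_mul] at hint
  have hin : inner ℝ (G θ) u = ∫ x in a..b, riskDeriv f p relu step θ x u := hG.inner_eq hR hf hp θ u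
  have hfin : (b - a) • (Q * (A * ‖u‖ ^ 2)) + Q * (A' * ‖u‖) * ∫ x in a..b, χ x ≤ C * ‖u‖ ^ 2 := by
    have : Q * (A' * ‖u‖) * ∫ x in a..b, χ x ≤
        Q * (A' * ‖u‖) * (h * ((4 + 2 * (b - a)) * (2 * M * ‖u‖))) := by gcongr
    rw [hC, smul_eq_mul]
    linarith
  have hmax : C * ‖u‖ ^ 2 ≤ max C 1 * ‖u‖ ^ 2 := by
    gcongr
    exact le_max_left _ _
  rw [hin]
  unfold risk
  linarith

end Descent

section AffineCoefficients

theorem integral_affine_sq (m n s t : ℝ) :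
    ∫ x in s..t, (m * x + n) ^ 2 =
      (t - s) * (m * ((s + t) / 2) + n) ^ 2 + (t - s) ^ 3 / 12 * m ^ 2 := by
  have h1 : ∀ x ∈ uIcc s t, HasDerivAt (fun x : ℝ => m ^ 2 * x ^ 3 / 3 + m * n * x ^ 2 + n ^ 2 * x)
      ((m * x + n) ^ 2) x := by
    intro x _
    have h2 := ((((hasDerivAt_pow 3 x).const_mul (m ^ 2)).div_const 3).add
      ((hasDerivAt_pow 2 x).const_mul (m * n))).add ((hasDerivAt_id x).const_mul (n ^ 2))
    refine h2.congr_deriv ?_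
    norm_num
    ring
  rw [intervalIntegral.integral_eq_sub_of_hasDerivAt h1
    ((by fun_prop : Continuous fun x : ℝ => (m * x + n) ^ 2).intervalIntegrable _ _)]
  ring

/-- The coefficients of an affine function are bounded by its `L²` norm on an interval whose length
is bounded from below. -/
theorem exists_affine_coeff_sq_le (M : ℝ) {ℓ : ℝ} (hℓ : 0 < ℓ) :
    ∃ Λ > 0, ∀ m n s t : ℝ, s + ℓ ≤ t → |s| ≤ M → |t| ≤ M →
      m ^ 2 ≤ Λ * ∫ x in s..t, (m * x + n) ^ 2 ∧ n ^ 2 ≤ Λ * ∫ x in s..t, (m * x + n) ^ 2 := by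
  refine ⟨12 / ℓ ^ 3 + 2 / ℓ + 2 * M ^ 2 * (12 / ℓ ^ 3), by positivity,
    fun m n s t hst hs ht => ?_⟩
  rw [integral_affine_sq]
  set c := (s + t) / 2
  set I := (t - s) * (m * c + n) ^ 2 + (t - s) ^ 3 / 12 * m ^ 2
  have hts : ℓ ≤ t - s := by linarith
  have hts0 : 0 < t - s := hℓ.trans_le hts
  have hc : c ^ 2 ≤ M ^ 2 := by
    rw [← sq_abs c]
    have : |c| ≤ M := by
      obtain ⟨h1, h2⟩ := abs_le.1 hs
      obtain ⟨h3, h4⟩ := abs_le.1 ht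
      exact abs_le.2 ⟨by simp only [c]; linarith, by simp only [c]; linarith⟩
    gcongr
  have hI : 0 ≤ I := by positivity
  have h1 : m ^ 2 ≤ 12 / ℓ ^ 3 * I := by
    have h2 : ℓ ^ 3 / 12 * m ^ 2 ≤ I := by
      have : ℓ ^ 3 / 12 * m ^ 2 ≤ (t - s) ^ 3 / 12 * m ^ 2 := by gcongr
      have h3 : 0 ≤ (t - s) * (m * c + n) ^ 2 := by positivity
      simp only [I]
      linarith
    calc m ^ 2 = 12 / ℓ ^ 3 * (ℓ ^ 3 / 12 * m ^ 2) := by field_simp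
      _ ≤ _ := by gcongr
  have h2 : (m * c + n) ^ 2 ≤ 1 / ℓ * I := by
    have h3 : ℓ * (m * c + n) ^ 2 ≤ I := by
      have : ℓ * (m * c + n) ^ 2 ≤ (t - s) * (m * c + n) ^ 2 := by gcongr
      have h3 : 0 ≤ (t - s) ^ 3 / 12 * m ^ 2 := by positivity
      simp only [I]
      linarith
    calc (m * c + n) ^ 2 = 1 / ℓ * (ℓ * (m * c + n) ^ 2) := by field_simp
      _ ≤ _ := by gcongr
  have h3 : m ^ 2 * c ^ 2 ≤ 12 / ℓ ^ 3 * I * M ^ 2 := by gcongr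
  have h4 : n ^ 2 ≤ 2 * (m * c + n) ^ 2 + 2 * (m ^ 2 * c ^ 2) := by
    nlinarith [sq_nonneg (m * c + n + m * c)]
  have h5 : 0 ≤ 12 / ℓ ^ 3 * I := by positivity
  have h6 : 0 ≤ 1 / ℓ * I := by positivity
  have h7 : 0 ≤ 12 / ℓ ^ 3 * I * M ^ 2 := by positivity
  have h8 : (12 / ℓ ^ 3 + 2 / ℓ + 2 * M ^ 2 * (12 / ℓ ^ 3)) * I =
    12 / ℓ ^ 3 * I + 2 * (1 / ℓ * I) + 2 * (12 / ℓ ^ 3 * I * M ^ 2) := by ring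
  rw [h8]
  constructor <;> linarith

end AffineCoefficients

namespace ParamSpace

variable {h : ℕ}

/-- The parameter vector with given inner weights, inner biases, outer weights and outer bias. -/
noncomputable def ofWeights (w c v : Fin h → ℝ) (d : ℝ) : ParamSpace h :=
  WithLp.toLp 2 fun i =>
    if h1 : (i : ℕ) < h then w ⟨i, h1⟩
    else if h2 : (i : ℕ) < 2 * h then c ⟨i - h, by omega⟩
    else if h3 : (i : ℕ) < 3 * h then v ⟨i - 2 * h, by omega⟩
    else d

variable (w c v : Fin h → ℝ) (d : ℝ)

@[simp] theorem innerWeight_ofWeights (j : Fin h) : (ofWeights w c v d).innerWeight j = w j := by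
  simp [innerWeight, ofWeights]

@[simp] theorem innerBias_ofWeights (j : Fin h) : (ofWeights w c v d).innerBias j = c j := by
  have h1 : ¬ h + (j : ℕ) < h := by omega
  have h2 : h + (j : ℕ) < 2 * h := by omega
  simp [innerBias, ofWeights, h2]

@[simp] theorem outerWeight_ofWeights (j : Fin h) : (ofWeights w c v d).outerWeight j = v j := by
  have h1 : ¬ 2 * h + (j : ℕ) < h := by omega
  have h2 : ¬ 2 * h + (j : ℕ) < 2 * h := by omega
  have h3 : 2 * h + (j : ℕ) < 3 * h := by omega
  simp [outerWeight, ofWeights, h1, h3]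

@[simp] theorem outerBias_ofWeights : (ofWeights w c v d).outerBias = d := by
  have h2 : ¬ 3 * h < 2 * h := by omega
  have h1 : ¬ 3 * h < h := by omega
  simp [outerBias, ofWeights, h1, h2]

@[simp] theorem preAct_ofWeights (j : Fin h) (x : ℝ) :
    (ofWeights w c v d).preAct j x = w j * x + c j := by
  simp [preAct]

variable {w c v d}

theorem norm_ofWeights_le {X : ℝ} (hX : 0 ≤ X) (hw : ∀ j, |w j| ≤ X) (hc : ∀ j, |c j| ≤ X)
    (hv : ∀ j, |v j| ≤ X) (hd : |d| ≤ X) : ‖ofWeights w c v d‖ ≤ (3 * h + 1) * X := by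
  have h1 : ∀ i, ‖ofWeights w c v d i‖ ≤ X := by
    intro i
    simp only [ofWeights, Real.norm_eq_abs]
    split_ifs
    · exact hw _
    · exact hc _
    · exact hv _
    · exact hd
  refine abs_le_of_sq_le_sq' ?_ (by positivity) |>.2
  rw [EuclideanSpace.norm_sq_eq]
  calc _ ≤ ∑ _i : Fin (3 * h + 1), X ^ 2 := Finset.sum_le_sum fun i _ => by
        have := h1 i
        gcongr
    _ = (3 * h + 1) * 1 * X ^ 2 := by simp
    _ ≤ (3 * h + 1) * (3 * h + 1) * X ^ 2 := by
        have : (0 : ℝ) ≤ h := Nat.cast_nonneg h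
        gcongr
        linarith
    _ = _ := by ring

end ParamSpace

section PolyakLojasiewicz

variable {h : ℕ} {a b : ℝ} {f p : ℝ → ℝ} {R : ℕ → ℝ → ℝ} {G : ParamSpace h → ParamSpace h}
  {j₀ : Fin h} {K : Finset (Fin h)} {ξ κ : Fin h → ℝ} {α β δ ε : ℝ} {θ : ParamSpace h}

/-- The function `f` is piecewise affine linear on `[a, b]` with genuine kinks at the points `ξ j`,
`j ∈ K`, which are separated from each other and from `a` and `b` by at least `2 * δ`. -/
structure HasKinks (a b : ℝ) (f : ℝ → ℝ) (j₀ : Fin h) (K : Finset (Fin h)) (ξ κ : Fin h → ℝ)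
    (α β δ : ℝ) : Prop where
  notMem : j₀ ∉ K
  ne_zero : ∀ j ∈ K, κ j ≠ 0
  pos : 0 < δ
  eq : ∀ x ∈ Icc a b, f x = α * x + β + ∑ j ∈ K, κ j * relu (x - ξ j)
  left : ∀ j ∈ K, a + 2 * δ ≤ ξ j
  right : ∀ j ∈ K, ξ j + 2 * δ ≤ b
  separated : ∀ j ∈ K, ∀ k ∈ K, j ≠ k → 2 * δ ≤ |ξ j - ξ k|
  length : a + 2 * δ ≤ b

/-- In the network with parameters `θ`, neuron `j₀` is active on `[a, b]`, the neurons in `K` have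
their kinks close to the kinks of the target function, and all other neurons are inactive. -/
structure IsAdapted (a b : ℝ) (j₀ : Fin h) (K : Finset (Fin h)) (ξ κ : Fin h → ℝ) (ε : ℝ)
    (θ : ParamSpace h) : Prop where
  active : ∀ x ∈ Icc a b, 1 / 2 ≤ θ.preAct j₀ x
  outerWeight_active : 1 / 2 ≤ θ.outerWeight j₀
  innerWeight : ∀ j ∈ K, 1 / 2 ≤ θ.innerWeight j
  outerWeight : ∀ j ∈ K, |κ j| / 2 ≤ |θ.outerWeight j|
  preAct_kink : ∀ j ∈ K, |θ.preAct j (ξ j)| ≤ ε / 2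
  inactive : ∀ j, j ∉ K → j ≠ j₀ → ∀ x ∈ Icc a b, θ.preAct j x ≤ -(1 / 2)

theorem IsAdapted.isTransversal (hθ : IsAdapted a b j₀ K ξ κ ε θ) : IsTransversal a b θ := by
  intro j
  by_cases hj : j ∈ K
  · exact Or.inl (hθ.innerWeight j hj)
  · refine Or.inr fun x hx => ?_
    rcases eq_or_ne j j₀ with rfl | hj0
    · exact (hθ.active x hx).trans (le_abs_self _)
    · have := hθ.inactive j hj hj0 x hx
      exact (by linarith : 1 / 2 ≤ -θ.preAct j x).trans (neg_le_abs _)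

theorem IsAdapted.sum_eq (hθ : IsAdapted a b j₀ K ξ κ ε θ) (hj₀ : j₀ ∉ K) {x : ℝ}
    (hx : x ∈ Icc a b) (F : Fin h → ℝ)
    (hF : ∀ j, θ.preAct j x ≤ 0 → F j = 0) :
    ∑ j, F j = F j₀ + ∑ j ∈ K, F j := by
  rw [← Finset.sum_insert hj₀]
  refine (Finset.sum_subset (Finset.subset_univ _) fun j _ hj => ?_).symm
  simp only [Finset.mem_insert, not_or] at hj
  exact hF j (by linarith [hθ.inactive j hj.2 hj.1 x hx])

/-- The slope of the jump that the error function has near the kink `j`. -/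
noncomputable def jumpSlope (κ : Fin h → ℝ) (θ : ParamSpace h) (j : Fin h) : ℝ :=
  θ.outerWeight j * θ.innerWeight j - κ j

/-- The constant term of the jump that the error function has near the kink `j`. -/
noncomputable def jumpConst (ξ κ : Fin h → ℝ) (θ : ParamSpace h) (j : Fin h) : ℝ :=
  θ.outerWeight j * θ.innerBias j + κ j * ξ j

theorem jump_eq (ξ κ : Fin h → ℝ) (θ : ParamSpace h) (j : Fin h) (x : ℝ) :
    jumpSlope κ θ j * x + jumpConst ξ κ θ j =
      θ.outerWeight j * θ.preAct j x - κ j * (x - ξ j) := by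
  simp only [jumpSlope, jumpConst, preAct]
  ring

/-- The slope of the error function near `a`. -/
noncomputable def baseSlope (j₀ : Fin h) (α : ℝ) (θ : ParamSpace h) : ℝ :=
  θ.outerWeight j₀ * θ.innerWeight j₀ - α

/-- The constant term of the error function near `a`. -/
noncomputable def baseConst (j₀ : Fin h) (β : ℝ) (θ : ParamSpace h) : ℝ :=
  θ.outerBias + θ.outerWeight j₀ * θ.innerBias j₀ - β

theorem error_eq (hf : HasKinks a b f j₀ K ξ κ α β δ) (hθ : IsAdapted a b j₀ K ξ κ ε θ) {x : ℝ}
    (hx : x ∈ Icc a b) :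
    realization relu θ x - f x = baseSlope j₀ α θ * x + baseConst j₀ β θ +
      ∑ j ∈ K, (θ.outerWeight j * relu (θ.preAct j x) - κ j * relu (x - ξ j)) := by
  rw [realization_eq, hf.eq x hx, hθ.sum_eq hf.notMem hx _ fun j hj => by simp [relu, hj],
    Finset.sum_sub_distrib]
  have h1 : relu (θ.preAct j₀ x) = θ.preAct j₀ x :=
    max_eq_left (by linarith [hθ.active x hx])
  rw [h1, baseSlope, baseConst, preAct]
  ring

theorem preAct_eq_add (θ : ParamSpace h) (j : Fin h) (x y : ℝ) :
    θ.preAct j x = θ.preAct j y + θ.innerWeight j * (x - y) := by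
  simp only [preAct]
  ring

theorem error_eq_of_far (hf : HasKinks a b f j₀ K ξ κ α β δ) (hθ : IsAdapted a b j₀ K ξ κ ε θ)
    {x : ℝ} (hx : x ∈ Icc a b) (hfar : ∀ j ∈ K, ε ≤ |x - ξ j|) :
    realization relu θ x - f x =
      (baseSlope j₀ α θ + ∑ j ∈ K with ξ j < x, jumpSlope κ θ j) * x +
        (baseConst j₀ β θ + ∑ j ∈ K with ξ j < x, jumpConst ξ κ θ j) := by
  have h1 : ∀ j ∈ K, θ.outerWeight j * relu (θ.preAct j x) - κ j * relu (x - ξ j) =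
      if ξ j < x then jumpSlope κ θ j * x + jumpConst ξ κ θ j else 0 := by
    intro j hj
    have h2 := hfar j hj
    have h3 := hθ.innerWeight j hj
    have h4 := abs_le.1 (hθ.preAct_kink j hj)
    have h5 := preAct_eq_add θ j x (ξ j)
    split_ifs with hlt
    · rw [abs_of_pos (by linarith)] at h2
      have h6 : 0 ≤ θ.preAct j x := by nlinarith
      rw [jump_eq, relu, relu, max_eq_left h6, max_eq_left (by linarith)]
    · rw [abs_of_nonpos (by linarith)] at h2
      have h6 : θ.preAct j x ≤ 0 := by nlinarith
      rw [relu, relu, max_eq_right h6, max_eq_right (by linarith)]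
      simp
  rw [error_eq hf hθ hx, Finset.sum_congr rfl h1, ← Finset.sum_filter, Finset.sum_add_distrib,
    ← Finset.sum_mul]
  ring

theorem affine_coeff_sq_le (hf : Continuous f) (hp : Continuous p)
    (hp_pos : ∀ x ∈ Icc a b, 0 < p x) {p₀ Λ m n s t : ℝ} (hp₀ : 0 < p₀)
    (hpp₀ : ∀ x ∈ Icc a b, p₀ ≤ p x) (hst : s ≤ t) (has : a ≤ s) (htb : t ≤ b) (hΛ : 0 < Λ)
    (hmn : m ^ 2 ≤ Λ * ∫ x in s..t, (m * x + n) ^ 2 ∧ n ^ 2 ≤ Λ * ∫ x in s..t, (m * x + n) ^ 2)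
    (heq : ∀ x ∈ Icc s t, realization relu θ x - f x = m * x + n) :
    |m| ≤ √(Λ / p₀ * risk a b f p relu θ) ∧ |n| ≤ √(Λ / p₀ * risk a b f p relu θ) := by
  have h1 : p₀ * ∫ x in s..t, (m * x + n) ^ 2 ≤ risk a b f p relu θ := by
    have h2 : p₀ * ∫ x in s..t, (m * x + n) ^ 2 ≤
        ∫ x in s..t, (f x - realization relu θ x) ^ 2 * p x := by
      rw [← intervalIntegral.integral_const_mul]
      refine intervalIntegral.integral_mono_on hst (Continuous.intervalIntegrable (by fun_prop) _ _)
        (intervalIntegrable_risk hf hp θ) fun x hx => ?_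
      have h3 : (f x - realization relu θ x) ^ 2 = (m * x + n) ^ 2 := by
        rw [← heq x hx]
        ring
      rw [h3, mul_comm]
      have := hpp₀ x ⟨has.trans hx.1, hx.2.trans htb⟩
      gcongr
    refine h2.trans ?_
    refine intervalIntegral.integral_mono_interval has hst htb ?_ (intervalIntegrable_risk hf hp θ)
    filter_upwards [ae_restrict_mem measurableSet_Ioc] with x hx
    exact mul_nonneg (sq_nonneg _) (hp_pos x (Ioc_subset_Icc_self hx)).le
  have h4 : Λ * ∫ x in s..t, (m * x + n) ^ 2 ≤ Λ / p₀ * risk a b f p relu θ := by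
    calc Λ * ∫ x in s..t, (m * x + n) ^ 2 = Λ / p₀ * (p₀ * ∫ x in s..t, (m * x + n) ^ 2) := by
          field_simp
      _ ≤ _ := by gcongr
  exact ⟨Real.abs_le_sqrt (hmn.1.trans h4), Real.abs_le_sqrt (hmn.2.trans h4)⟩

/-- The jumps of the error function are controlled by the risk. -/
theorem exists_jump_le (hf : Continuous f) (hp : Continuous p) (hp_pos : ∀ x ∈ Icc a b, 0 < p x)
    (hk : HasKinks a b f j₀ K ξ κ α β δ) :
    ∃ Λ > 0, ∀ θ : ParamSpace h, ∀ ε ≤ δ / 2, IsAdapted a b j₀ K ξ κ ε θ →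
      (|baseSlope j₀ α θ| ≤ √(Λ * risk a b f p relu θ) ∧
        |baseConst j₀ β θ| ≤ √(Λ * risk a b f p relu θ)) ∧
      ∀ j ∈ K, |jumpSlope κ θ j| ≤ 2 * √(Λ * risk a b f p relu θ) ∧
        |jumpConst ξ κ θ j| ≤ 2 * √(Λ * risk a b f p relu θ) := by
  have hδ := hk.pos
  have hab : a ≤ b := by linarith [hk.length]
  obtain ⟨M, hM, hxM⟩ := exists_abs_le_of_continuous (g := fun x => x) continuous_id a b
  obtain ⟨p₀, hp₀, hpp₀⟩ : ∃ p₀ > 0, ∀ x ∈ Icc a b, p₀ ≤ p x := by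
    obtain ⟨y, hy, hmin⟩ := isCompact_Icc.exists_isMinOn (nonempty_Icc.2 hab) hp.continuousOn
    exact ⟨p y, hp_pos y hy, fun x hx => hmin hx⟩
  obtain ⟨Λ, hΛ, hcoeff⟩ := exists_affine_coeff_sq_le M (half_pos hδ)
  refine ⟨Λ / p₀, by positivity, fun θ ε hε hθ => ?_⟩
  have key : ∀ (T : Finset (Fin h)) (s t : ℝ), s + δ / 2 ≤ t → a ≤ s → t ≤ b →
      (∀ x ∈ Icc s t, (∀ j ∈ K, ε ≤ |x - ξ j|) ∧ (K.filter fun j => ξ j < x) = T) →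
      |baseSlope j₀ α θ + ∑ j ∈ T, jumpSlope κ θ j| ≤ √(Λ / p₀ * risk a b f p relu θ) ∧
      |baseConst j₀ β θ + ∑ j ∈ T, jumpConst ξ κ θ j| ≤ √(Λ / p₀ * risk a b f p relu θ) := by
    intro T s t hst has htb hT
    have hst' : s ≤ t := by linarith
    refine affine_coeff_sq_le hf hp hp_pos hp₀ hpp₀ hst' has htb hΛ
      (hcoeff _ _ s t hst (hxM s ⟨has, by linarith⟩) (hxM t ⟨by linarith, htb⟩)) fun x hx => ?_
    rw [error_eq_of_far hk hθ ⟨has.trans hx.1, hx.2.trans htb⟩ (hT x hx).1, (hT x hx).2]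
  constructor
  · have h1 := key ∅ a (a + δ) (by linarith) le_rfl (by linarith [hk.length]) fun x hx => by
      have h2 : ∀ j ∈ K, δ ≤ ξ j - x := fun j hj => by linarith [hk.left j hj, hx.2]
      refine ⟨fun j hj => ?_, Finset.filter_eq_empty_iff.2 fun j hj => ?_⟩
      · rw [abs_sub_comm]
        exact (by linarith [h2 j hj] : ε ≤ ξ j - x).trans (le_abs_self _)
      · linarith [h2 j hj]
    simpa using h1
  · intro j hj
    have hjl := hk.left j hj
    have hjr := hk.right j hj
    have hother : ∀ x ∈ Icc (ξ j - δ) (ξ j + δ), ∀ k ∈ K, k ≠ j →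
        ε ≤ |x - ξ k| ∧ (ξ k < x ↔ ξ k < ξ j) := by
      intro x hx k hk' hkj
      rcases le_abs.1 (hk.separated k hk' j hj hkj) with h1 | h1
      · refine ⟨?_, ⟨fun h2 => ?_, fun h2 => ?_⟩⟩
        · rw [abs_sub_comm]
          exact (by linarith [hx.2] : ε ≤ ξ k - x).trans (le_abs_self _)
        · linarith [hx.2]
        · linarith
      · refine ⟨(by linarith [hx.1] : ε ≤ x - ξ k).trans (le_abs_self _),
          ⟨fun h2 => ?_, fun h2 => ?_⟩⟩
        · linarith
        · linarith [hx.1]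
    have h1 := key (K.filter fun k => ξ k < ξ j) (ξ j - δ) (ξ j - δ / 2) (by linarith)
      (by linarith) (by linarith) fun x hx => by
        refine ⟨fun k hk' => ?_, Finset.filter_congr fun k hk' => ?_⟩
        · rcases eq_or_ne k j with rfl | hkj
          · rw [abs_sub_comm]
            exact (by linarith [hx.2] : ε ≤ ξ k - x).trans (le_abs_self _)
          · exact (hother x ⟨hx.1, by linarith [hx.2]⟩ k hk' hkj).1
        · rcases eq_or_ne k j with rfl | hkj
          · exact ⟨fun h2 => by linarith [hx.2], fun h2 => absurd h2 (lt_irrefl _)⟩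
          · exact (hother x ⟨hx.1, by linarith [hx.2]⟩ k hk' hkj).2
    have h2 := key (insert j (K.filter fun k => ξ k < ξ j)) (ξ j + δ / 2) (ξ j + δ) (by linarith)
      (by linarith) (by linarith) fun x hx => by
        refine ⟨fun k hk' => ?_, ?_⟩
        · rcases eq_or_ne k j with rfl | hkj
          · exact (by linarith [hx.1] : ε ≤ x - ξ k).trans (le_abs_self _)
          · exact (hother x ⟨by linarith [hx.1], hx.2⟩ k hk' hkj).1
        · ext k
          simp only [Finset.mem_filter, Finset.mem_insert]
          rcases eq_or_ne k j with rfl | hkj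
          · simp only [true_or, iff_true]
            exact ⟨hj, by linarith [hx.1]⟩
          · simp only [hkj, false_or]
            exact and_congr_right fun hk' => (hother x ⟨by linarith [hx.1], hx.2⟩ k hk' hkj).2
    rw [Finset.sum_insert (by simp), Finset.sum_insert (by simp)] at h2
    obtain ⟨⟨h3, h4⟩, ⟨h5, h6⟩⟩ := And.intro h1 h2
    rw [abs_le] at h3 h4 h5 h6
    constructor <;> rw [abs_le] <;> constructor <;> linarith

theorem abs_kink_mismatch_le {w z y k : ℝ} (hw : 1 / 2 ≤ w) (hz : |z| ≤ ε / 2) :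
    |k * (relu y - y * step (z + w * y))| ≤
      2 * |k| * |z| * {y : ℝ | |y| ≤ ε}.indicator 1 y := by
  have hind : 0 ≤ {y : ℝ | |y| ≤ ε}.indicator (1 : ℝ → ℝ) y :=
    indicator_nonneg (fun _ _ => zero_le_one) _
  by_cases hy : |y| ≤ 2 * |z|
  · have h1 : |relu y - y * step (z + w * y)| ≤ |y| := by
      rw [relu_eq_mul_step, ← mul_sub, abs_mul]
      refine mul_le_of_le_one_right (abs_nonneg _) ?_
      rcases lt_or_ge 0 y with h2 | h2 <;> rcases lt_or_ge 0 (z + w * y) with h3 | h3 <;>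
        simp [step_of_pos, step_of_nonpos, h2, h3]
    rw [indicator_of_mem (by rw [mem_ofPred_eq]; linarith), Pi.one_apply, mul_one, abs_mul]
    calc |k| * |relu y - y * step (z + w * y)| ≤ |k| * (2 * |z|) := by
          gcongr
          exact h1.trans hy
      _ = 2 * |k| * |z| := by ring
  · push Not at hy
    have h0 : relu y - y * step (z + w * y) = 0 := by
      obtain ⟨h3, h4⟩ := neg_abs_le z, le_abs_self z
      rcases lt_abs.1 hy with h1 | h1
      · have h2 : 0 < y := by linarith [abs_nonneg z]
        rw [relu_eq_mul_step, step_of_pos h2, step_of_pos (by nlinarith [neg_abs_le z]), sub_self]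
      · have h2 : y ≤ 0 := by linarith [abs_nonneg z]
        rw [relu_eq_mul_step, step_of_nonpos h2, step_of_nonpos (by nlinarith [le_abs_self z]),
          sub_self]
    rw [h0, mul_zero, abs_zero]
    positivity

/-- The Polyak–Łojasiewicz inequality for the risk near a network that represents the target
function with as few active neurons as possible. -/
theorem exists_pl (hab : a < b) (hf : Continuous f) (hp : Continuous p)
    (hp_pos : ∀ x ∈ Icc a b, 0 < p x) (hR : ApproximatesRelu R)
    (hG : IsGeneralizedGradient a b f p R G) (hk : HasKinks a b f j₀ K ξ κ α β δ) :
    ∃ ε > 0, ∃ μ > 0, ∀ θ : ParamSpace h, IsAdapted a b j₀ K ξ κ ε θ →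
      μ * risk a b f p relu θ ≤ ‖G θ‖ ^ 2 := by
  obtain ⟨Λ, hΛ, hjump⟩ := exists_jump_le hf hp hp_pos hk
  obtain ⟨M, hM, hxM⟩ := exists_abs_le_of_continuous (g := fun x => x) continuous_id a b
  obtain ⟨Q, hQ, hpQ⟩ := exists_abs_le_of_continuous hp a b
  have hδ := hk.pos
  obtain ⟨ε, hε, hεδ, hεs⟩ : ∃ ε > 0, ε ≤ δ / 2 ∧
      Q * (256 * M ^ 2 * Λ) * (h * (h * (2 * ε))) ≤ 1 / 2 := by
    have hD : (0 : ℝ) < 4 * (Q * (256 * M ^ 2 * Λ)) * (h ^ 2 + 1) := by positivity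
    refine ⟨min (δ / 2) (1 / (4 * (Q * (256 * M ^ 2 * Λ)) * (h ^ 2 + 1))), by positivity,
      min_le_left _ _, ?_⟩
    set ε := min (δ / 2) (1 / (4 * (Q * (256 * M ^ 2 * Λ)) * (h ^ 2 + 1)))
    have h1 : ε ≤ 1 / (4 * (Q * (256 * M ^ 2 * Λ)) * (h ^ 2 + 1)) := min_le_right _ _
    rw [le_div_iff₀ hD] at h1
    have h2 : 0 ≤ ε * (Q * (256 * M ^ 2 * Λ)) := by positivity
    linarith
  set k₀ : ℝ := 2 + ∑ j ∈ K, 2 / |κ j| with hk₀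
  have hk₀2 : 2 ≤ k₀ := le_add_of_nonneg_right (Finset.sum_nonneg fun j _ => by positivity)
  have hk₀j : ∀ j ∈ K, 2 / |κ j| ≤ k₀ := fun j hj =>
    (Finset.single_le_sum (f := fun j => 2 / |κ j|) (fun j _ => by positivity) hj).trans
      (by linarith)
  set D : ℝ := (3 * h + 1) * k₀ with hD
  have hD0 : 0 < D := by positivity
  refine ⟨ε, hε, 1 / (16 * D ^ 2 * Λ), by positivity, fun θ hθ => ?_⟩
  set L := risk a b f p relu θ with hL
  have hL0 : 0 ≤ L := intervalIntegral.integral_nonneg hab.le fun x hx =>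
    mul_nonneg (sq_nonneg _) (hp_pos x hx).le
  obtain ⟨⟨hs0, ht0⟩, hj⟩ := hjump θ ε hεδ hθ
  set X := 2 * √(Λ * L) with hX
  have hX0 : 0 ≤ X := by positivity
  have hX2 : X ^ 2 = 4 * Λ * L := by
    rw [hX, mul_pow, Real.sq_sqrt (by positivity)]
    ring
  have hsX : √(Λ * L) ≤ X := by linarith [Real.sqrt_nonneg (Λ * L)]
  have hv0 : 0 < θ.outerWeight j₀ := by linarith [hθ.outerWeight_active]
  have hvj : ∀ j ∈ K, θ.outerWeight j ≠ 0 := fun j hj => by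
    have h1 := hθ.outerWeight j hj
    have h2 := abs_pos.2 (hk.ne_zero j hj)
    exact abs_pos.1 (by linarith)
  have hnotK : ∀ j ∈ K, j ≠ j₀ := fun j hj hjj => hk.notMem (hjj ▸ hj)
  set w : Fin h → ℝ := fun j => if j = j₀ then baseSlope j₀ α θ / θ.outerWeight j₀ else
    if j ∈ K then jumpSlope κ θ j / θ.outerWeight j else 0 with hw
  set c : Fin h → ℝ := fun j => if j = j₀ then baseConst j₀ β θ / θ.outerWeight j₀ else
    if j ∈ K then jumpConst ξ κ θ j / θ.outerWeight j else 0 with hc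
  set u : ParamSpace h := ofWeights w c 0 0 with hu
  have hdiv0 : ∀ y : ℝ, |y| ≤ √(Λ * L) → |y / θ.outerWeight j₀| ≤ k₀ * X := by
    intro y hy
    rw [abs_div, abs_of_pos hv0, div_le_iff₀ hv0]
    have := hθ.outerWeight_active
    calc |y| ≤ 1 * X := by linarith
      _ ≤ (k₀ * θ.outerWeight j₀) * X := by
        gcongr
        nlinarith
      _ = _ := by ring
  have hdivj : ∀ j ∈ K, ∀ y : ℝ, |y| ≤ X → |y / θ.outerWeight j| ≤ k₀ * X := by
    intro j hj y hy
    have h1 := abs_pos.2 (hk.ne_zero j hj)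
    rw [abs_div, div_eq_inv_mul]
    refine mul_le_mul ?_ hy (abs_nonneg _) (by linarith)
    refine le_trans ?_ (hk₀j j hj)
    rw [inv_le_comm₀ (abs_pos.2 (hvj j hj)) (by positivity), inv_div]
    exact hθ.outerWeight j hj
  have hkX : 0 ≤ k₀ * X := by positivity
  have hunorm : ‖u‖ ≤ D * X := by
    rw [hD, mul_assoc]
    refine norm_ofWeights_le hkX (fun j => ?_) (fun j => ?_) (fun _ => by simpa using hkX)
      (by simpa using hkX)
    · simp only [hw]
      split_ifs with h1 h2
      · exact hdiv0 _ hs0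
      · exact hdivj j h2 _ (hj j h2).1
      · simpa using hkX
    · simp only [hc]
      split_ifs with h1 h2
      · exact hdiv0 _ ht0
      · exact hdivj j h2 _ (hj j h2).2
      · simpa using hkX
  have hφ : ∀ x ∈ Icc a b, realizationDeriv relu step θ x u = baseSlope j₀ α θ * x +
      baseConst j₀ β θ + ∑ j ∈ K, (jumpSlope κ θ j * x + jumpConst ξ κ θ j) *
        step (θ.preAct j x) := by
    intro x hx
    rw [realizationDeriv_apply, hθ.sum_eq hk.notMem hx _ fun j hj => by
      simp [hu, step_of_nonpos hj]]
    have h1 : step (θ.preAct j₀ x) = 1 := step_of_pos (by linarith [hθ.active x hx])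
    have h2 : ∀ j ∈ K, u.outerWeight j * relu (θ.preAct j x) +
        θ.outerWeight j * step (θ.preAct j x) * u.preAct j x =
        (jumpSlope κ θ j * x + jumpConst ξ κ θ j) * step (θ.preAct j x) := by
      intro j hj
      have h3 := hvj j hj
      simp only [hu, outerWeight_ofWeights, preAct_ofWeights, hw, hc, hnotK j hj, hj, if_true,
        if_false, Pi.zero_apply, zero_mul, zero_add]
      field_simp
    rw [Finset.sum_congr rfl h2, h1]
    simp only [hu, outerWeight_ofWeights, preAct_ofWeights, outerBias_ofWeights, hw, hc, if_true,
      Pi.zero_apply, zero_mul, zero_add]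
    field_simp
  set χ : ℝ → ℝ := fun x => ∑ j ∈ K, {y : ℝ | |y - ξ j| ≤ ε}.indicator 1 x with hχ
  have hind : ∀ (S : Set ℝ) (x : ℝ), 0 ≤ S.indicator (1 : ℝ → ℝ) x := fun S x =>
    indicator_nonneg (fun _ _ => zero_le_one) _
  have hdiff : ∀ x ∈ Icc a b,
      (realizationDeriv relu step θ x u - (realization relu θ x - f x)) ^ 2 ≤
        256 * M ^ 2 * Λ * L * (h * χ x) := by
    intro x hx
    have h1 : realizationDeriv relu step θ x u - (realization relu θ x - f x) =
        ∑ j ∈ K, κ j * (relu (x - ξ j) - (x - ξ j) *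
          step (θ.preAct j (ξ j) + θ.innerWeight j * (x - ξ j))) := by
      rw [hφ x hx, error_eq hk hθ hx, add_sub_add_left_eq_sub, ← Finset.sum_sub_distrib]
      refine Finset.sum_congr rfl fun j _ => ?_
      rw [← preAct_eq_add, jump_eq, relu_eq_mul_step (θ.preAct j x)]
      ring
    have h2 : ∀ j ∈ K, |κ j * (relu (x - ξ j) - (x - ξ j) *
          step (θ.preAct j (ξ j) + θ.innerWeight j * (x - ξ j)))| ≤
        8 * M * X * {y : ℝ | |y - ξ j| ≤ ε}.indicator 1 x := by
      intro j hjK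
      refine (abs_kink_mismatch_le (hθ.innerWeight j hjK) (hθ.preAct_kink j hjK)).trans ?_
      have h3 : {y : ℝ | |y| ≤ ε}.indicator (1 : ℝ → ℝ) (x - ξ j) =
        {y : ℝ | |y - ξ j| ≤ ε}.indicator 1 x := rfl
      rw [h3]
      refine mul_le_mul_of_nonneg_right ?_ (hind _ _)
      have h4 : θ.outerWeight j * θ.preAct j (ξ j) =
          jumpSlope κ θ j * ξ j + jumpConst ξ κ θ j := by
        rw [jump_eq]
        ring
      have h5 : |θ.outerWeight j| * |θ.preAct j (ξ j)| ≤ X * M + X := by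
        rw [← abs_mul, h4]
        refine (abs_add_le _ _).trans (add_le_add ?_ (hj j hjK).2)
        rw [abs_mul]
        refine mul_le_mul (hj j hjK).1 (hxM _ ⟨?_, ?_⟩) (abs_nonneg _) hX0
        · linarith [hk.left j hjK]
        · linarith [hk.right j hjK]
      have h6 := hθ.outerWeight j hjK
      have h7 : |κ j| * |θ.preAct j (ξ j)| ≤ 2 * |θ.outerWeight j| * |θ.preAct j (ξ j)| := by
        gcongr
        linarith
      have h8 : X ≤ X * M := le_mul_of_one_le_right hX0 hM
      linarith
    rw [h1, ← sq_abs]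
    have h3 : |∑ j ∈ K, κ j * (relu (x - ξ j) - (x - ξ j) *
          step (θ.preAct j (ξ j) + θ.innerWeight j * (x - ξ j)))| ≤ 8 * M * X * χ x := by
      rw [hχ, Finset.mul_sum]
      exact (Finset.abs_sum_le_sum_abs _ _).trans (Finset.sum_le_sum h2)
    have h4 : χ x ^ 2 ≤ h * χ x := by
      have h5 : χ x ^ 2 ≤ K.card * ∑ j ∈ K, ({y : ℝ | |y - ξ j| ≤ ε}.indicator 1 x : ℝ) ^ 2 :=
        sq_sum_le_card_mul_sum_sq
      have h6 : ∀ j ∈ K, ({y : ℝ | |y - ξ j| ≤ ε}.indicator 1 x : ℝ) ^ 2 =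
          {y : ℝ | |y - ξ j| ≤ ε}.indicator 1 x := by
        intro j _
        by_cases h7 : x ∈ {y : ℝ | |y - ξ j| ≤ ε} <;> simp [h7]
      rw [Finset.sum_congr rfl h6] at h5
      refine h5.trans (mul_le_mul_of_nonneg_right ?_ (Finset.sum_nonneg fun j _ => hind _ _))
      exact_mod_cast (Finset.card_le_univ K).trans_eq (Fintype.card_fin h)
    calc _ ≤ (8 * M * X * χ x) ^ 2 := by gcongr
      _ = 64 * M ^ 2 * X ^ 2 * χ x ^ 2 := by ring
      _ ≤ 64 * M ^ 2 * X ^ 2 * (h * χ x) := by gcongr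
      _ = _ := by rw [hX2]; ring
  have hpt : ∀ x ∈ Icc a b, (f x - realization relu θ x) ^ 2 * p x -
      Q * (256 * M ^ 2 * Λ * L * h) * χ x ≤ riskDeriv f p relu step θ x u := by
    intro x hx
    have h1 := hdiff x hx
    have hp0 := hp_pos x hx
    have hpx : p x ≤ Q := (le_abs_self _).trans (hpQ x hx)
    have h2 : 256 * M ^ 2 * Λ * L * (h * χ x) * p x ≤ 256 * M ^ 2 * Λ * L * (h * χ x) * Q := by
      have h3 : 0 ≤ χ x := Finset.sum_nonneg fun j _ => hind _ _
      gcongr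
    have h4 : riskDeriv f p relu step θ x u =
        2 * (realization relu θ x - f x) * p x * realizationDeriv relu step θ x u := rfl
    rw [h4]
    set e := realization relu θ x - f x
    set φ := realizationDeriv relu step θ x u
    have h5 : (f x - realization relu θ x) ^ 2 = e ^ 2 := by simp only [e]; ring
    rw [h5]
    have h6 : (φ - e) ^ 2 * p x ≤ 256 * M ^ 2 * Λ * L * (h * χ x) * p x := by gcongr
    have h7 : 0 ≤ φ ^ 2 * p x := by positivity
    have h8 : (φ - e) ^ 2 * p x = φ ^ 2 * p x - 2 * e * p x * φ + e ^ 2 * p x := by ring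
    linarith
  have hχj : ∀ j, IntervalIntegrable ({y : ℝ | |y - ξ j| ≤ ε}.indicator (1 : ℝ → ℝ)) volume a b :=
    fun j => intervalIntegrable_indicator_one
      (isClosed_le (by fun_prop) continuous_const).measurableSet
  have hχi : IntervalIntegrable χ volume a b := by
    simpa only [hχ, Finset.sum_fn] using IntervalIntegrable.sum K fun j _ => hχj j
  have hχle : ∫ x in a..b, χ x ≤ h * (2 * ε) := by
    rw [hχ, intervalIntegral.integral_finsetSum fun j _ => hχj j]
    calc _ ≤ ∑ _j ∈ K, 2 * ε :=
          Finset.sum_le_sum fun j _ => integral_indicator_abs_sub_le hab.le _ hε.le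
      _ = K.card * (2 * ε) := by simp
      _ ≤ _ := by
        gcongr
        exact (Finset.card_le_univ K).trans_eq (Fintype.card_fin h)
  have hi2 : IntervalIntegrable (fun x => riskDeriv f p relu step θ x u) volume a b :=
    ⟨(intervalIntegrable_riskDeriv hf hp hR θ).1.apply_continuousLinearMap u,
      (intervalIntegrable_riskDeriv hf hp hR θ).2.apply_continuousLinearMap u⟩
  have hint := intervalIntegral.integral_mono_on hab.le
    ((intervalIntegrable_risk hf hp θ).sub (hχi.const_mul _)) hi2 hpt
  rw [intervalIntegral.integral_sub (intervalIntegrable_risk hf hp θ) (hχi.const_mul _),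
    intervalIntegral.integral_const_mul] at hint
  have hin : inner ℝ (G θ) u = ∫ x in a..b, riskDeriv f p relu step θ x u :=
    hG.inner_eq hR hf hp θ u
  rw [← hin] at hint
  have hlow : L - L / 2 ≤ inner ℝ (G θ) u := by
    have h1 : Q * (256 * M ^ 2 * Λ * L * h) * ∫ x in a..b, χ x ≤
        Q * (256 * M ^ 2 * Λ * L * h) * (h * (2 * ε)) := by gcongr
    have h2 : Q * (256 * M ^ 2 * Λ) * (h * (h * (2 * ε))) * L ≤ 1 / 2 * L := by gcongr
    have h3 : L = ∫ x in a..b, (f x - realization relu θ x) ^ 2 * p x := rfl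
    linarith
  have hup : inner ℝ (G θ) u ≤ ‖G θ‖ * (D * X) :=
    (real_inner_le_norm _ _).trans (by gcongr)
  have hsq : (L / 2) ^ 2 ≤ (‖G θ‖ * (D * X)) ^ 2 := by
    have : L / 2 ≤ ‖G θ‖ * (D * X) := by linarith
    gcongr
  rw [mul_pow, mul_pow, hX2] at hsq
  rcases hL0.eq_or_lt with h0 | h0
  · rw [← h0, mul_zero]
    positivity
  · rw [one_div, inv_mul_le_iff₀ (by positivity)]
    have h1 : L * L ≤ L * (16 * D ^ 2 * Λ * ‖G θ‖ ^ 2) := by linarith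
    exact le_of_mul_le_mul_left h1 h0

end PolyakLojasiewicz

section Kinks

variable {h N : ℕ} {X A B : ℕ → ℝ} {f : ℝ → ℝ}

theorem piecewise_affine_eq_sum_relu (hX : ∀ i k, i < k → k ≤ N → X i < X k)
    (hf : ∀ i < N, ∀ y ∈ Icc (X i) (X (i + 1)), f y = A i * y + B i) (m : ℕ) (hm : m < N) :
    (∀ y ∈ Icc (X 0) (X (m + 1)), f y =
      A 0 * y + B 0 + ∑ i ∈ Finset.range m, (A (i + 1) - A i) * relu (y - X (i + 1))) ∧
    ∀ y, X m ≤ y →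
      A 0 * y + B 0 + ∑ i ∈ Finset.range m, (A (i + 1) - A i) * relu (y - X (i + 1)) =
        A m * y + B m := by
  induction m with
  | zero => exact ⟨fun y hy => by simpa using hf 0 hm y hy, by simp⟩
  | succ m ih =>
    obtain ⟨ih1, ih2⟩ := ih (by omega)
    have hlt : X m < X (m + 1) := hX m (m + 1) (by omega) (by omega)
    have hlt' : X (m + 1) < X (m + 2) := hX (m + 1) (m + 2) (by omega) (by omega)
    have hglue : A m * X (m + 1) + B m = A (m + 1) * X (m + 1) + B (m + 1) := by
      rw [← hf m (by omega) _ (right_mem_Icc.2 hlt.le), ← hf (m + 1) hm _ (left_mem_Icc.2 hlt'.le)]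
    have h2 : ∀ y, X (m + 1) ≤ y → A 0 * y + B 0 +
        ∑ i ∈ Finset.range (m + 1), (A (i + 1) - A i) * relu (y - X (i + 1)) =
        A (m + 1) * y + B (m + 1) := by
      intro y hy
      rw [Finset.sum_range_succ, ← add_assoc, ih2 y (hlt.le.trans hy), relu,
        max_eq_left (sub_nonneg.2 hy)]
      linarith
    refine ⟨fun y hy => ?_, h2⟩
    rcases le_total y (X (m + 1)) with hle | hle
    · rw [ih1 y ⟨hy.1, hle⟩, Finset.sum_range_succ, relu, max_eq_right (sub_nonpos.2 hle), mul_zero,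
        add_zero]
    · rw [h2 y hle, hf (m + 1) hm y ⟨hle, hy.2⟩]

theorem exists_hasKinks (hN : 1 ≤ N) (hNh : N ≤ h) (hX : ∀ i k, i < k → k ≤ N → X i < X k)
    (hf : ∀ i < N, ∀ y ∈ Icc (X i) (X (i + 1)), f y = A i * y + B i) :
    ∃ (j₀ : Fin h) (K : Finset (Fin h)) (ξ κ : Fin h → ℝ) (α β δ : ℝ),
      HasKinks (X 0) (X N) f j₀ K ξ κ α β δ := by
  classical
  obtain ⟨δ, hδ, hδ0⟩ : ∃ δ : ℝ, (∀ i k : Fin (N + 1), i < k → X i + 2 * δ ≤ X k) ∧ 0 < δ := by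
    have h1 : ∀ᶠ δ : ℝ in 𝓝[>] 0, ∀ i k : Fin (N + 1), i < k → X i + 2 * δ ≤ X k := by
      simp only [eventually_all]
      intro i k hik
      have hc : Continuous fun δ : ℝ => X i + 2 * δ := by fun_prop
      have h2 := hX i k hik (by omega)
      filter_upwards [nhdsWithin_le_nhds ((hc.tendsto' 0 (X i) (by simp)).eventually
        (gt_mem_nhds h2))] with δ hδ using hδ.le
    exact (h1.and self_mem_nhdsWithin).exists
  have hgap : ∀ i k : ℕ, i < k → k ≤ N → X i + 2 * δ ≤ X k := fun i k hik hk =>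
    hδ ⟨i, by omega⟩ ⟨k, by omega⟩ (Fin.mk_lt_mk.2 hik)
  refine ⟨⟨0, by omega⟩,
    Finset.univ.filter fun j => (1 ≤ (j : ℕ) ∧ (j : ℕ) < N) ∧ A j - A (j - 1) ≠ 0, fun j => X j,
    fun j => A j - A (j - 1), A 0, B 0, δ, ?_⟩
  refine ⟨by simp, fun j hj => (Finset.mem_filter.1 hj).2.2, hδ0, fun y hy => ?_,
    fun j hj => ?_, fun j hj => ?_, fun j hj k hk hjk => ?_, hgap 0 N (by omega) le_rfl⟩
  · have h1 := (piecewise_affine_eq_sum_relu hX hf (N - 1) (by omega)).1 y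
      (by rwa [Nat.sub_add_cancel hN])
    rw [h1]
    congr 1
    set F : ℕ → ℝ := fun i => (A i - A (i - 1)) * relu (y - X i)
    have h2 : ∑ i ∈ Finset.range (N - 1), (A (i + 1) - A i) * relu (y - X (i + 1)) =
        ∑ i ∈ Finset.Ico 1 N, F i := by
      rw [Finset.sum_Ico_eq_sum_range]
      refine Finset.sum_congr rfl fun i _ => ?_
      simp only [F, add_comm 1 i, Nat.add_sub_cancel]
    have h3 : Finset.Ico 1 N = {i ∈ Finset.range h | 1 ≤ i ∧ i < N} := by
      ext i
      simp only [Finset.mem_Ico, Finset.mem_filter, Finset.mem_range]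
      omega
    rw [h2, h3, Finset.sum_filter, ← Fin.sum_univ_eq_sum_range (fun i =>
      if 1 ≤ i ∧ i < N then F i else 0) h, Finset.sum_filter]
    refine Finset.sum_congr rfl fun j _ => ?_
    by_cases h4 : A j - A (j - 1) = 0
    · simp [F, h4]
    · simp [F, h4]
  · have := (Finset.mem_filter.1 hj).2.1
    exact hgap 0 j (by omega) (by omega)
  · have := (Finset.mem_filter.1 hj).2.1
    exact hgap j N (by omega) le_rfl
  · have h1 := (Finset.mem_filter.1 hj).2.1
    have h2 := (Finset.mem_filter.1 hk).2.1
    rcases lt_or_gt_of_ne (fun e => hjk (Fin.ext e) : (j : ℕ) ≠ k) with h3 | h3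
    · have := hgap j k h3 (by omega)
      rw [abs_sub_comm]
      exact (by linarith : 2 * δ ≤ X k - X j).trans (le_abs_self _)
    · have := hgap k j h3 (by omega)
      exact (by linarith : 2 * δ ≤ X j - X k).trans (le_abs_self _)

end Kinks

section GlobalMinimum

variable {h : ℕ} {a b : ℝ} {f p : ℝ → ℝ} {R : ℕ → ℝ → ℝ} {G : ParamSpace h → ParamSpace h}
  {j₀ : Fin h} {K : Finset (Fin h)} {ξ κ : Fin h → ℝ} {α β δ ε : ℝ}

theorem IsAdapted.of_norm_sub_le {M r : ℝ} (hM : 1 ≤ M) (hxM : ∀ x ∈ Icc a b, |x| ≤ M)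
    (hξ : ∀ j ∈ K, ξ j ∈ Icc a b) {ϑ θ : ParamSpace h}
    (hactive : ∀ x ∈ Icc a b, 1 ≤ ϑ.preAct j₀ x) (hv₀ : ϑ.outerWeight j₀ = 1)
    (hw : ∀ j ∈ K, ϑ.innerWeight j = 1) (hv : ∀ j ∈ K, ϑ.outerWeight j = κ j)
    (hz : ∀ j ∈ K, ϑ.preAct j (ξ j) = 0)
    (hinactive : ∀ j, j ∉ K → j ≠ j₀ → ∀ x ∈ Icc a b, ϑ.preAct j x ≤ -1)
    (hr1 : 2 * M * r ≤ 1 / 2) (hrε : 2 * M * r ≤ ε / 2) (hrκ : ∀ j ∈ K, r ≤ |κ j| / 2)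
    (hθ : ‖θ - ϑ‖ ≤ r) : IsAdapted a b j₀ K ξ κ ε θ := by
  have hr0 : 0 ≤ r := (norm_nonneg _).trans hθ
  have hr : r ≤ 1 / 2 := by nlinarith
  have hpre : ∀ j, ∀ x ∈ Icc a b, |θ.preAct j x - ϑ.preAct j x| ≤ 2 * M * r := by
    intro j x hx
    rw [← preAct_sub]
    exact (abs_preAct_le hM _ j (hxM x hx)).trans (by gcongr)
  have hout : ∀ j, |θ.outerWeight j - ϑ.outerWeight j| ≤ r := fun j =>
    (abs_outerWeight_le (θ - ϑ) j).trans hθ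
  have hinn : ∀ j, |θ.innerWeight j - ϑ.innerWeight j| ≤ r := fun j =>
    (abs_innerWeight_le (θ - ϑ) j).trans hθ
  refine ⟨fun x hx => ?_, ?_, fun j hj => ?_, fun j hj => ?_, fun j hj => ?_,
    fun j hj hj₀ x hx => ?_⟩
  · linarith [(abs_le.1 (hpre j₀ x hx)).1, hactive x hx]
  · linarith [(abs_le.1 (hout j₀)).1]
  · linarith [(abs_le.1 (hinn j)).1, hw j hj]
  · have h1 := abs_sub_abs_le_abs_sub (ϑ.outerWeight j) (θ.outerWeight j)
    rw [abs_sub_comm] at h1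
    have h2 := hout j
    rw [hv j hj] at h1 h2
    linarith [hrκ j hj]
  · have h1 := hpre j _ (hξ j hj)
    rw [hz j hj, sub_zero] at h1
    linarith
  · linarith [(abs_le.1 (hpre j x hx)).2, hinactive j hj hj₀ x hx]

/-- There is a global minimum with risk zero all of whose neighbors are adapted to the target
function. -/
theorem exists_adapted_zero (hk : HasKinks a b f j₀ K ξ κ α β δ) (hε : 0 < ε) :
    ∃ ϑ : ParamSpace h, risk a b f p relu ϑ = 0 ∧
      ∃ r > 0, ∀ θ ∈ Metric.ball ϑ r, IsAdapted a b j₀ K ξ κ ε θ := by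
  have hab : a ≤ b := by linarith [hk.length, hk.pos]
  obtain ⟨M, hM, hxM⟩ := exists_abs_le_of_continuous (g := fun x => x) continuous_id a b
  set w : Fin h → ℝ := fun j => if j = j₀ then α else if j ∈ K then 1 else 0 with hw
  set c : Fin h → ℝ := fun j => if j = j₀ then 1 + |α| * M else if j ∈ K then -ξ j else -1 with hc
  set v : Fin h → ℝ := fun j => if j = j₀ then 1 else if j ∈ K then κ j else 0 with hv
  set ϑ : ParamSpace h := ofWeights w c v (β - (1 + |α| * M)) with hϑ
  have hnotK : ∀ j ∈ K, j ≠ j₀ := fun j hj hjj => hk.notMem (hjj ▸ hj)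
  have hξ : ∀ j ∈ K, ξ j ∈ Icc a b := fun j hj =>
    ⟨by linarith [hk.left j hj, hk.pos], by linarith [hk.right j hj, hk.pos]⟩
  have hactive : ∀ x ∈ Icc a b, 1 ≤ ϑ.preAct j₀ x := by
    intro x hx
    have h1 : -(|α| * M) ≤ α * x := by
      refine neg_le_of_abs_le ?_
      rw [abs_mul]
      exact mul_le_mul_of_nonneg_left (hxM x hx) (abs_nonneg _)
    simp only [hϑ, preAct_ofWeights, hw, hc, if_true]
    linarith
  have hw1 : ∀ j ∈ K, ϑ.innerWeight j = 1 := fun j hj => by simp [hϑ, hw, hnotK j hj, hj]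
  have hv1 : ∀ j ∈ K, ϑ.outerWeight j = κ j := fun j hj => by simp [hϑ, hv, hnotK j hj, hj]
  have hz1 : ∀ j ∈ K, ∀ x, ϑ.preAct j x = x - ξ j := fun j hj x => by
    simp [hϑ, hw, hc, hnotK j hj, hj, sub_eq_add_neg]
  have hv₀ : ϑ.outerWeight j₀ = 1 := by simp [hϑ, hv]
  have hinactive : ∀ j, j ∉ K → j ≠ j₀ → ∀ x ∈ Icc a b, ϑ.preAct j x ≤ -1 :=
    fun j hj hj₀ x _ => by simp [hϑ, hw, hc, hj, hj₀]
  set r : ℝ := min (min (1 / (4 * M)) (ε / (4 * M))) ((insert j₀ K).inf' (by simp)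
    fun j => if j ∈ K then |κ j| / 2 else 1) with hr
  have hr0 : 0 < r := by
    refine lt_min (by positivity) ((Finset.lt_inf'_iff _).2 fun j _ => ?_)
    split_ifs with hj
    · exact half_pos (abs_pos.2 (hk.ne_zero j hj))
    · exact one_pos
  have hadapt : ∀ θ : ParamSpace h, ‖θ - ϑ‖ ≤ r → IsAdapted a b j₀ K ξ κ ε θ := by
    intro θ hθ
    have h1 : r ≤ 1 / (4 * M) := (min_le_left _ _).trans (min_le_left _ _)
    have h2 : r ≤ ε / (4 * M) := (min_le_left _ _).trans (min_le_right _ _)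
    rw [le_div_iff₀ (by positivity)] at h1 h2
    refine IsAdapted.of_norm_sub_le hM hxM hξ hactive hv₀ hw1 hv1
      (fun j hj => by rw [hz1 j hj, sub_self]) hinactive (by linarith) (by linarith)
      (fun j hj => ?_) hθ
    refine (min_le_right _ _).trans ((Finset.inf'_le _ (Finset.mem_insert_of_mem hj)).trans_eq ?_)
    simp [hj]
  refine ⟨ϑ, ?_, r, hr0, fun θ hθ => hadapt θ (mem_ball_iff_norm.1 hθ).le⟩
  have hzero : ∀ x ∈ uIcc a b, (f x - realization relu ϑ x) ^ 2 * p x = 0 := by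
    intro x hx
    rw [uIcc_of_le hab] at hx
    have h1 := error_eq hk (hadapt ϑ (by simpa using hr0.le)) hx
    have h2 : baseSlope j₀ α ϑ = 0 := by simp [baseSlope, hϑ, hw, hv]
    have h3 : baseConst j₀ β ϑ = 0 := by simp [baseConst, hϑ, hc, hv]
    have h4 : ∑ j ∈ K, (ϑ.outerWeight j * relu (ϑ.preAct j x) - κ j * relu (x - ξ j)) = 0 :=
      Finset.sum_eq_zero fun j hj => by rw [hv1 j hj, hz1 j hj, sub_self]
    rw [h2, h3, h4, zero_mul, add_zero, add_zero, sub_eq_zero] at h1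
    rw [h1, sub_self, zero_pow two_ne_zero, zero_mul]
  rw [risk, intervalIntegral.integral_congr hzero, intervalIntegral.integral_zero]

theorem risk_nonneg (hab : a ≤ b) (hp_pos : ∀ x ∈ Icc a b, 0 < p x) (θ : ParamSpace h) :
    0 ≤ risk a b f p relu θ :=
  intervalIntegral.integral_nonneg hab fun x hx => mul_nonneg (sq_nonneg _) (hp_pos x hx).le

theorem exists_exp_bound_of_hasKinks (hf : Continuous f) (hp : Continuous p)
    (hp_pos : ∀ x ∈ Icc a b, 0 < p x) (hR : ApproximatesRelu R)
    (hG : IsGeneralizedGradient a b f p R G) (hk : HasKinks a b f j₀ K ξ κ α β δ) :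
    ∃ ϑ : ParamSpace h, ∃ η > 0, ∃ c > 0, ∀ γ ∈ Ioc 0 c, ∀ s : ℕ → ParamSpace h,
      s 0 ∈ Metric.ball ϑ η → (∀ n, s (n + 1) = s n - γ • G (s n)) →
        ∀ n : ℕ, risk a b f p relu (s n) ≤ Real.exp (-(c * γ * n)) := by
  have hab : a < b := by linarith [hk.length, hk.pos]
  obtain ⟨ε, hε, μ, hμ, hpl⟩ := exists_pl hab hf hp hp_pos hR hG hk
  obtain ⟨ϑ, hϑ, r, hr, hadapt⟩ := exists_adapted_zero (p := p) hk hε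
  obtain ⟨C, hC, hdesc⟩ := exists_risk_add_le hab hf hp hp_pos hR hG (‖ϑ‖ + r)
  refine ⟨ϑ, exists_exp_bound_of_descent_of_pl hr hμ hC (risk_nonneg hab.le hp_pos) hϑ
    (fun θ hθ => hdesc θ ?_ (hadapt θ hθ).isTransversal) fun θ hθ => hpl θ (hadapt θ hθ)⟩
  have h1 := norm_le_norm_add_norm_sub' θ ϑ
  have h2 := mem_ball_iff_norm.1 hθ
  linarith

theorem risk_congr {f' p' : ℝ → ℝ} (hab : a ≤ b) (hf : EqOn f f' (Icc a b))
    (hp : EqOn p p' (Icc a b)) (σ : ℝ → ℝ) :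
    (fun θ : ParamSpace h => risk a b f p σ θ) = fun θ => risk a b f' p' σ θ := by
  funext θ
  refine intervalIntegral.integral_congr fun x hx => ?_
  rw [uIcc_of_le hab] at hx
  simp only [hf hx, hp hx]

end GlobalMinimum

theorem exists_hasKinks_of_partition {h N : ℕ} (hN : 1 ≤ N) (hNh : N ≤ h) {x : Fin (N + 1) → ℝ}
    (hx : StrictMono x) {f : ℝ → ℝ}
    (hf : ∀ i : Fin N, ∃ α β : ℝ, ∀ y ∈ Icc (x i.castSucc) (x i.succ), f y = α * y + β) :
    ∃ (j₀ : Fin h) (K : Finset (Fin h)) (ξ κ : Fin h → ℝ) (α β δ : ℝ),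
      HasKinks (x 0) (x (Fin.last N)) f j₀ K ξ κ α β δ := by
  choose A B hAB using hf
  have h1 := exists_hasKinks (h := h) (f := f) (X := fun i => x ⟨min i N, by omega⟩)
    (A := fun i => if hi : i < N then A ⟨i, hi⟩ else 0)
    (B := fun i => if hi : i < N then B ⟨i, hi⟩ else 0) hN hNh
    (fun i k hik hk => hx (Fin.mk_lt_mk.2 (by omega))) fun i hi y hy => by
      simp only [hi, dif_pos]
      refine hAB ⟨i, hi⟩ y ?_
      have e1 : (⟨min i N, by omega⟩ : Fin (N + 1)) = Fin.castSucc ⟨i, hi⟩ :=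
        Fin.ext (by simp; omega)
      have e2 : (⟨min (i + 1) N, by omega⟩ : Fin (N + 1)) = Fin.succ ⟨i, hi⟩ :=
        Fin.ext (by simp; omega)
      rwa [e1, e2] at hy
  have e1 : (⟨min 0 N, by omega⟩ : Fin (N + 1)) = 0 := Fin.ext (by simp)
  have e2 : (⟨min N N, by omega⟩ : Fin (N + 1)) = Fin.last N := Fin.ext (by simp)
  rwa [e1, e2] at h1

theorem limsup_coe_eq_zero_of_le_exp {L : ℕ → ℝ} {C c : ℝ} (hL : ∀ n, 0 ≤ L n) (hc : 0 < c)
    (h : ∀ n : ℕ, L n ≤ C * Real.exp (-(c * n))) :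
    limsup (fun n => ((L n : ℝ) : EReal)) atTop = 0 := by
  have h1 : Tendsto (fun n : ℕ => C * Real.exp (-(c * n))) atTop (𝓝 0) := by
    rw [← mul_zero C]
    refine (Real.tendsto_exp_atBot.comp ?_).const_mul C
    exact tendsto_neg_atTop_atBot.comp
      (tendsto_natCast_atTop_atTop.const_mul_atTop hc)
  have h2 : Tendsto L atTop (𝓝 0) := squeeze_zero hL h h1
  exact (EReal.tendsto_coe.2 h2).limsup_eq

theorem theorem1p2
    (h N : ℕ) (hN : 1 ≤ N) (hNh : N ≤ h)
    (a b : ℝ) (hab : a < b)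
    (x : Fin (N + 1) → ℝ) (hx : StrictMono x) (hx_first : x 0 = a) (hx_last : x (Fin.last N) = b)
    (f : ℝ → ℝ) (hf_cont : ContinuousOn f (Icc a b))
    (hf_affine : ∀ i : Fin N, ∃ α β : ℝ, ∀ y ∈ Icc (x i.castSucc) (x i.succ), f y = α * y + β)
    (R : ℕ → ℝ → ℝ) (hR : ApproximatesRelu R)
    (p : ℝ → ℝ) (hp_pos : ∀ y ∈ Icc a b, 0 < p y) (hp_lip : ∃ K, LipschitzOnWith K p (Icc a b))
    {Ω : Type*} [MeasurableSpace Ω] (P : Measure Ω) [IsProbabilityMeasure P]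
    (Θ : ℝ → ℕ → Ω → ParamSpace h) (hΘ_meas : ∀ γ n, Measurable (Θ γ n))
    (hΘ_init : ∀ γ, P.map (Θ γ 0) = stdGaussian (ParamSpace h))
    (G : ParamSpace h → ParamSpace h) (hG : IsGeneralizedGradient a b f p R G)
    (hΘ_step : ∀ γ n ω, Θ γ (n + 1) ω = Θ γ n ω - γ • G (Θ γ n ω)) :
    ∃ c C : ℝ, 0 < c ∧ 0 < C ∧ ∀ γ ∈ Ioc (0 : ℝ) c,
      P {ω | limsup (fun n => ((risk a b f p relu (Θ γ n ω) : ℝ) : EReal)) atTop = 0}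
          ≥ P {ω | ∀ n : ℕ, risk a b f p relu (Θ γ n ω) ≤ C * Real.exp (-(c * γ * n))} ∧
        P {ω | ∀ n : ℕ, risk a b f p relu (Θ γ n ω) ≤ C * Real.exp (-(c * γ * n))}
          ≥ ENNReal.ofReal c := by
  obtain ⟨j₀, K, ξ, κ, α, β, δ, hk⟩ := exists_hasKinks_of_partition hN hNh hx hf_affine
  rw [hx_first, hx_last] at hk
  obtain ⟨_, hp_lip⟩ := hp_lip
  set f' : ℝ → ℝ := IccExtend hab.le ((Icc a b).domRestrict f)
  set p' : ℝ → ℝ := IccExtend hab.le ((Icc a b).domRestrict p)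
  have hff' : EqOn f f' (Icc a b) := fun y hy =>
    (IccExtend_of_mem hab.le ((Icc a b).domRestrict f) hy).symm
  have hpp' : EqOn p p' (Icc a b) := fun y hy =>
    (IccExtend_of_mem hab.le ((Icc a b).domRestrict p) hy).symm
  have hG' : IsGeneralizedGradient a b f' p' R G := by
    intro θ g hg
    refine hG θ g ?_
    simpa only [risk_congr hab.le hff' hpp'] using hg
  have hk' : HasKinks a b f' j₀ K ξ κ α β δ :=
    { hk with eq := fun y hy => by rw [← hff' hy, hk.eq y hy] }
  obtain ⟨ϑ, η, hη, c, hc, hconv⟩ := exists_exp_bound_of_hasKinks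
    (hf_cont.domRestrict.Icc_extend') (hp_lip.continuousOn.domRestrict.Icc_extend')
    (fun y hy => (hp_pos y hy).trans_eq (hpp' hy)) hR hG' hk'
  have hrisk : ∀ θ : ParamSpace h, risk a b f p relu θ = risk a b f' p' relu θ := fun θ =>
    congrFun (risk_congr hab.le hff' hpp' relu) θ
  have hpos : 0 < stdGaussian (ParamSpace h) (Metric.ball ϑ η) := by
    have := isOpenPosMeasure_stdGaussian (Fin (3 * h + 1))
    exact Metric.measure_ball_pos _ _ hη
  set q := (stdGaussian (ParamSpace h) (Metric.ball ϑ η)).toReal with hq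
  have hfin : stdGaussian (ParamSpace h) (Metric.ball ϑ η) ≠ ⊤ := measure_ne_top _ _
  have hq0 : 0 < q := ENNReal.toReal_pos hpos.ne' hfin
  refine ⟨min c q, 1, lt_min hc hq0, one_pos, fun γ hγ => ⟨?_, ?_⟩⟩
  · refine measure_mono fun ω hω => ?_
    exact limsup_coe_eq_zero_of_le_exp (fun n => risk_nonneg hab.le hp_pos _)
      (mul_pos (lt_min hc hq0) hγ.1) hω
  · have hsub : Θ γ 0 ⁻¹' Metric.ball ϑ η ⊆
        {ω | ∀ n : ℕ, risk a b f p relu (Θ γ n ω) ≤ 1 * Real.exp (-(min c q * γ * n))} := by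
      intro ω hω n
      rw [hrisk, one_mul]
      refine (hconv γ ⟨hγ.1, hγ.2.trans (min_le_left _ _)⟩ (fun n => Θ γ n ω) hω
        (fun n => hΘ_step γ n ω) n).trans (Real.exp_le_exp.2 (neg_le_neg ?_))
      have := hγ.1
      gcongr
      exact min_le_left _ _
    calc ENNReal.ofReal (min c q) ≤ ENNReal.ofReal q :=
          ENNReal.ofReal_le_ofReal (min_le_right _ _)
      _ = P.map (Θ γ 0) (Metric.ball ϑ η) := by rw [hq, ENNReal.ofReal_toReal hfin, hΘ_init γ]
      _ = P (Θ γ 0 ⁻¹' Metric.ball ϑ η) :=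
        Measure.map_apply (hΘ_meas γ 0) Metric.isOpen_ball.measurableSet
      _ ≤ _ := measure_mono hsub
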